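/- A real symmetric $3\times3$ matrix $C$ is called an ellipse matrix if $(x,y,0)\,C\,(x,y,0)^T>0$ for all $(x,y)\ne(0,0)$ and $\det C<0$; it represents the ellipse $\mathcal C=\{(x,y)\in\mathbb R^2: u^TCu=0,\ u=(x,y,1)^T\}$. Let $C_o,C_i$ be two ellipse matrices such that $\mathcal C_i$ lies inside $\mathcal C_o$, i.e. $u^TC_ou<0$ whenever $u\in\mathbb R^3\setminus\{0\}$ and $u^TC_iu=0$, and such that $C_o^{-1}C_i$ has three distinct positive eigenvalues $\lambda_1>\lambda_2>\lambda_3>0$. The Poncelet map $P:\mathcal C_o\to\mathcal C_o$ of the pair sends $z_0\in\mathcal C_o$ to the unique point $z_1\in\mathcal C_o$, $z_1\neq z_0$, such that the oriented segment from $z_0$ to $z_1$ is tangent to $\mathcal C_i$ with $\mathcal C_i$ on its left. This is a well-defined map which has a lift to $\mathbb R$ (a continuous nondecreasing $F:\mathbb R\to\mathbb R$ with $F(t+1)=F(t)+1$) under the counterclockwise covering $\mathbb R\to\mathcal C_o$ of period $1$ given by the polar angle at the centre of $\mathcal C_o$. Its rotation number $\rho\in[0,1)$ is the limit $\lim_{n\to\infty}(F^n(t)-t)/n$,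 reduced modulo $1$. Then: 1. $\rho=\tfrac14$ if and only if $\lambda_1\lambda_2-\lambda_1\lambda_3-\lambda_2\lambda_3=0$; 2. $\rho=\tfrac13$ if and only if $\dfrac1{\sqrt{\lambda_3}}=\dfrac1{\sqrt{\lambda_1}}+\dfrac1{\sqrt{\lambda_2}}$; 3. $\rho=\tfrac16$ if and only if $\sqrt{1-\dfrac{\lambda_3}{\lambda_1}}+\sqrt{1-\dfrac{\lambda_3}{\lambda_2}}=1$. These conditions generalize the bicentric conditions in the following sense. Let $a,r,R>0$ with $r+a<R$. The matrices $$C_o=\begin{pmatrix}1&0&0\\0&1&0\\0&0&-R^2\end{pmatrix},\qquad C_i=\begin{pmatrix}1&0&-a\\0&1&0\\-a&0&a^2-r^2\end{pmatrix}$$ of the circles $x^2+y^2=R^2$ and $(x-a)^2+y^2=r^2$ satisfy all the hypotheses above, and for their eigenvalues $\lambda_1>\lambda_2>\lambda_3>0$ the condition in 1 is equivalent to Fuss's condition $\frac1{(R-a)^2}+\frac1{(R+a)^2}=\frac1{r^2}$, and the condition in 2 to the Euler–Chapple condition $\frac1{R-a}+\frac1{R+a}=\frac1r$. -/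

import Mathlib

open Matrix

/-- The quadratic form `u ↦ uᵀ C u` on `ℝ³`. -/
def quadForm (C : Matrix (Fin 3) (Fin 3) ℝ) (u : Fin 3 → ℝ) : ℝ :=
  u ⬝ᵥ (C *ᵥ u)

/-- The conic in the plane represented by `C`: all `(x, y)` with `uᵀ C u = 0`, `u = (x, y, 1)`. -/
def conic (C : Matrix (Fin 3) (Fin 3) ℝ) : Set (ℝ × ℝ) :=
  {z | quadForm C ![z.1, z.2, 1] = 0}

/-- Matrices of ordered signature `(+, +, -)`; their conics are the (real, nondegenerate)
ellipses. -/
structure IsEllipseMatrix (C : Matrix (Fin 3) (Fin 3) ℝ) : Prop where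
  symm : C.IsSymm
  pos : ∀ x y : ℝ, (x, y) ≠ (0, 0) → 0 < quadForm C ![x, y, 0]
  det_neg : C.det < 0

/-- `Co` and `Ci` represent an outer and an inner ellipse, the inner one lying inside the outer
one, and `lam₁ > lam₂ > lam₃ > 0` are the eigenvalues of `Co⁻¹ Ci`. -/
structure IsEllipsePair (Co Ci : Matrix (Fin 3) (Fin 3) ℝ) (lam₁ lam₂ lam₃ : ℝ) : Prop where
  outer : IsEllipseMatrix Co
  inner : IsEllipseMatrix Ci
  inside : ∀ u : Fin 3 → ℝ, u ≠ 0 → quadForm Ci u = 0 → quadForm Co u < 0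
  eigen₁ : Module.End.HasEigenvalue (Matrix.toLin' (Co⁻¹ * Ci)) lam₁
  eigen₂ : Module.End.HasEigenvalue (Matrix.toLin' (Co⁻¹ * Ci)) lam₂
  eigen₃ : Module.End.HasEigenvalue (Matrix.toLin' (Co⁻¹ * Ci)) lam₃
  lt₁₂ : lam₂ < lam₁
  lt₂₃ : lam₃ < lam₂
  pos₃ : 0 < lam₃

/-- The vector `v` is tangent to the conic of the symmetric matrix `C` at its point `w`: the
derivative of `(x, y) ↦ uᵀ C u`, `u = (x, y, 1)`, at `w` in direction `v` vanishes. -/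
def IsTangentAt (C : Matrix (Fin 3) (Fin 3) ℝ) (w v : ℝ × ℝ) : Prop :=
  w ∈ conic C ∧ ![v.1, v.2, 0] ⬝ᵥ (C *ᵥ ![w.1, w.2, 1]) = 0

/-- `w` lies in the closed half plane to the left of the oriented line from `z₀` to `z₁`. -/
def IsOnLeft (z₀ z₁ w : ℝ × ℝ) : Prop :=
  0 ≤ (z₁.1 - z₀.1) * (w.2 - z₀.2) - (z₁.2 - z₀.2) * (w.1 - z₀.1)

/-- The oriented segment from `z₀` to `z₁` is tangent to the conic of `Ci`, at one of the points of
the segment, and that conic appears on its left. -/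
def IsPonceletStep (Ci : Matrix (Fin 3) (Fin 3) ℝ) (z₀ z₁ : ℝ × ℝ) : Prop :=
  z₁ ≠ z₀ ∧ (∃ w ∈ segment ℝ z₀ z₁, IsTangentAt Ci w (z₁ - z₀)) ∧
    ∀ w ∈ conic Ci, IsOnLeft z₀ z₁ w

/-- `P` is the Poncelet map of the outer conic of `Co` with respect to the inner conic of `Ci`. -/
def IsPonceletMap (Co Ci : Matrix (Fin 3) (Fin 3) ℝ) (P : conic Co → conic Co) : Prop :=
  ∀ z : conic Co, IsPonceletStep Ci (z : ℝ × ℝ) (P z : ℝ × ℝ)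

/-- The determinant of the upper left `2 × 2` block. -/
def minorDet (C : Matrix (Fin 3) (Fin 3) ℝ) : ℝ :=
  C 0 0 * C 1 1 - C 0 1 ^ 2

/-- The centre of the ellipse of `C`. -/
noncomputable def center (C : Matrix (Fin 3) (Fin 3) ℝ) : ℝ × ℝ :=
  ((C 0 1 * C 1 2 - C 1 1 * C 0 2) / minorDet C, (C 0 1 * C 0 2 - C 0 0 * C 1 2) / minorDet C)

/-- The distance from the centre of the ellipse of `C` to the ellipse in the direction `θ`. -/
noncomputable def radius (C : Matrix (Fin 3) (Fin 3) ℝ) (θ : ℝ) : ℝ :=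
  √(-C.det / (minorDet C * quadForm C ![Real.cos θ, Real.sin θ, 0]))

/-- The counterclockwise covering `ℝ → ` ellipse of `C`, of period one, by the polar angle at the
centre, measured in full turns. -/
noncomputable def ellipseCover (C : Matrix (Fin 3) (Fin 3) ℝ) (t : ℝ) : ℝ × ℝ :=
  ((center C).1 + radius C (2 * Real.pi * t) * Real.cos (2 * Real.pi * t),
    (center C).2 + radius C (2 * Real.pi * t) * Real.sin (2 * Real.pi * t))

/-- `F` is a lift of the self-map `P` of the ellipse of `C`: a continuous nondecreasing map of the
line with `F (t + 1) = F t + 1` which the covering carries to `P`. -/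
def IsLift (C : Matrix (Fin 3) (Fin 3) ℝ) (P : conic C → conic C) (F : CircleDeg1Lift) : Prop :=
  Continuous F ∧
    ∀ (t : ℝ) (z : conic C), (z : ℝ × ℝ) = ellipseCover C t →
      (P z : ℝ × ℝ) = ellipseCover C (F t)

open Classical in
/-- The rotation number of an orientation preserving homeomorphism `P` of the ellipse of `C`: the
limit of `(Fⁿ t - t) / n` for a lift `F` of `P`, reduced modulo one to the interval `[0, 1)`. It
does not depend on the lift, since two lifts differ by an integer. -/
noncomputable def rotationNumber (C : Matrix (Fin 3) (Fin 3) ℝ) (P : conic C → conic C) : ℝ :=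
  if h : ∃ F : CircleDeg1Lift, IsLift C P F then
    Int.fract (CircleDeg1Lift.translationNumber h.choose)
  else 0

/-- The matrix of the circle `(x - a)² + y² = r²`. -/
def circleMatrix (a r : ℝ) : Matrix (Fin 3) (Fin 3) ℝ :=
  !![1, 0, -a; 0, 1, 0; -a, 0, a ^ 2 - r ^ 2]

/-! The eigenvectors of `Co⁻¹ * Ci` are orthogonal for both quadratic forms. Suitably scaled, they
form a projective frame in which the outer ellipse is the unit circle and the inner one is x²/a² +
y²/b² = 1, with a² = λ₃/λ₁ and b² = λ₃/λ₂, so 0 < a < b < 1 (`IsEllipsePair.exists_frame`). The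
frame has positive determinant and sends no point of the closed disc to infinity, so it respects
segments, tangency and sides. The Poncelet map thus becomes the explicit angle map `chordMap`
(`framePoint_step_unique`, `isPonceletStep_chordMap`). Passing from the circle parameter to the
polar angle at the centre is a change of coordinate of degree one, which leaves the translation
number unchanged (`exists_angle`, `exists_lift`).

In the normal form a tangent chord from t to u satisfies A cos t cos u + B sin t sin u = C, with A =
1 + b² - a², B = 1 - b² + a², C = a² + b² - 1. Differentiation gives du/√W(u) = dt/√W(t) with W = A²
cos² + B² sin² - C², so an elliptic integral conjugates `chordMap` to a translation. Hence one orbit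
closes after n steps and one turn if and only if all do (`iterate_chordMap_eq`). Since a translation
number is 1/n exactly when some point advances by one turn in n steps, ρ = 1/n is a condition on the
orbit of the angle 0 alone (`translationNumber_turnMap_eq_iff`).

That orbit starts on an axis, so a closed polygon through it inherits the reflections of the
ellipse, and these locate its vertices. For n = 4 the next vertex is at π/2; for n = 3 the opposite
side is x = -a; for n = 6 the second side is y = b. The relation at t = 0 then factors into a² + b²
= 1, a + b = 1 and √(1 - a²) + √(1 - b²) = 1 respectively.

For two circles, 1 is the largest eigenvalue and the other two are the roots of a quadratic; their
sum and product turn the conditions into those of Fuss and Euler–Chapple. -/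

/-! ### The Poncelet map in normal form -/

/-- The slope parameter of the tangent chord from `(cos t, sin t)`: the tangent of half the angle
subtended by the chord of the unit circle which touches `x² / a² + y² / b² = 1`. -/
noncomputable def chordTan (a b t : ℝ) : ℝ :=
  (√(a ^ 2 * Real.sin t ^ 2 + b ^ 2 * Real.cos t ^ 2 - a ^ 2 * b ^ 2) -
    (b ^ 2 - a ^ 2) * (Real.sin t * Real.cos t)) / (a ^ 2 * Real.sin t ^ 2 + b ^ 2 * Real.cos t ^ 2)

/-- The Poncelet map of the unit circle and the ellipse `x² / a² + y² / b² = 1`, lifted to angles. -/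
noncomputable def chordMap (a b t : ℝ) : ℝ :=
  t + 2 * Real.arctan (chordTan a b t)

/-- Semi-axes of an ellipse, not a circle, inside the unit circle. -/
structure IsAxes (a b : ℝ) : Prop where
  pos : 0 < a
  lt : a < b
  lt_one : b < 1

namespace IsAxes

variable {a b : ℝ}

lemma pos' (h : IsAxes a b) : 0 < b := h.pos.trans h.lt

lemma sq_lt_one (h : IsAxes a b) : a ^ 2 < 1 := by
  nlinarith [h.pos, h.lt, h.lt_one]

lemma sq_lt_one' (h : IsAxes a b) : b ^ 2 < 1 := by
  nlinarith [h.pos, h.lt, h.lt_one]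

lemma combo_pos {x y : ℝ} (hx : 0 < x) (hy : 0 < y) (t : ℝ) :
    0 < x * Real.sin t ^ 2 + y * Real.cos t ^ 2 := by
  rcases eq_or_ne (Real.sin t) 0 with h0 | h0
  · have : Real.cos t ^ 2 = 1 := by nlinarith [Real.sin_sq_add_cos_sq t]
    rw [h0, this]; simpa using hy
  · have := mul_pos hx (pow_pos (abs_pos.mpr h0) 2)
    rw [sq_abs] at this
    nlinarith [mul_nonneg hy.le (sq_nonneg (Real.cos t))]

lemma disc_pos (h : IsAxes a b) (t : ℝ) :
    0 < a ^ 2 * Real.sin t ^ 2 + b ^ 2 * Real.cos t ^ 2 - a ^ 2 * b ^ 2 := by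
  have h1 := combo_pos (mul_pos (pow_pos h.pos 2) (sub_pos.mpr h.sq_lt_one'))
    (mul_pos (pow_pos h.pos' 2) (sub_pos.mpr h.sq_lt_one)) t
  have h2 := Real.sin_sq_add_cos_sq t
  have h3 : a ^ 2 * b ^ 2 = a ^ 2 * b ^ 2 * (Real.sin t ^ 2 + Real.cos t ^ 2) := by rw [h2, mul_one]
  rw [h3]; linarith

lemma den_pos (h : IsAxes a b) (t : ℝ) : 0 < a ^ 2 * Real.sin t ^ 2 + b ^ 2 * Real.cos t ^ 2 :=
  combo_pos (pow_pos h.pos 2) (pow_pos h.pos' 2) t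

/-- The quadratic equation of `chordTan` has roots of opposite signs. -/
lemma const_pos (h : IsAxes a b) (t : ℝ) :
    0 < 1 - a ^ 2 * Real.cos t ^ 2 - b ^ 2 * Real.sin t ^ 2 := by
  have h1 := combo_pos (sub_pos.mpr h.sq_lt_one') (sub_pos.mpr h.sq_lt_one) t
  linarith [Real.sin_sq_add_cos_sq t]

/-- The radicand in `chordTan` is the reduced discriminant q² + p r of the quadratic p T² + 2 q T -
r; it exceeds q² because p and r are positive. -/
lemma disc_eq (t : ℝ) :
    a ^ 2 * Real.sin t ^ 2 + b ^ 2 * Real.cos t ^ 2 - a ^ 2 * b ^ 2 =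
      ((b ^ 2 - a ^ 2) * (Real.sin t * Real.cos t)) ^ 2 +
        (a ^ 2 * Real.sin t ^ 2 + b ^ 2 * Real.cos t ^ 2) *
          (1 - a ^ 2 * Real.cos t ^ 2 - b ^ 2 * Real.sin t ^ 2) := by
  have hc : Real.cos t ^ 2 = 1 - Real.sin t ^ 2 := by linarith [Real.sin_sq_add_cos_sq t]
  rw [mul_pow, mul_pow, hc]; ring

lemma chordTan_pos (h : IsAxes a b) (t : ℝ) : 0 < chordTan a b t := by
  refine div_pos (sub_pos.mpr ?_) (h.den_pos t)
  refine (le_abs_self _).trans_lt ?_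
  rw [← Real.sqrt_sq_eq_abs]
  refine Real.sqrt_lt_sqrt (sq_nonneg _) ?_
  rw [disc_eq]
  linarith [mul_pos (h.den_pos t) (h.const_pos t)]

lemma chordTan_quadratic (h : IsAxes a b) (t : ℝ) :
    (a ^ 2 * Real.sin t ^ 2 + b ^ 2 * Real.cos t ^ 2) * chordTan a b t ^ 2 +
      2 * ((b ^ 2 - a ^ 2) * (Real.sin t * Real.cos t)) * chordTan a b t -
        (1 - a ^ 2 * Real.cos t ^ 2 - b ^ 2 * Real.sin t ^ 2) = 0 := by
  have hp := (h.den_pos t).ne'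
  have hs := Real.sq_sqrt (h.disc_pos t).le
  have hd := disc_eq (a := a) (b := b) t
  rw [chordTan]
  generalize √(a ^ 2 * Real.sin t ^ 2 + b ^ 2 * Real.cos t ^ 2 - a ^ 2 * b ^ 2) = S at *
  generalize a ^ 2 * Real.sin t ^ 2 + b ^ 2 * Real.cos t ^ 2 - a ^ 2 * b ^ 2 = D at *
  generalize a ^ 2 * Real.sin t ^ 2 + b ^ 2 * Real.cos t ^ 2 = p at *
  generalize (b ^ 2 - a ^ 2) * (Real.sin t * Real.cos t) = q at *
  generalize 1 - a ^ 2 * Real.cos t ^ 2 - b ^ 2 * Real.sin t ^ 2 = r at *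
  field_simp
  linear_combination hs + hd

/-- The chord from t to t + 2d lies on x cos(t + d) + y sin(t + d) = cos d. It is tangent when cos²
d equals the squared support function of the ellipse in the direction t + d; dividing by cos² d
leaves a quadratic in tan d. -/
lemma tangency_iff_quadratic {t d : ℝ} (hd : Real.cos d ≠ 0) :
    a ^ 2 * Real.cos (t + d) ^ 2 + b ^ 2 * Real.sin (t + d) ^ 2 = Real.cos d ^ 2 ↔
    (a ^ 2 * Real.sin t ^ 2 + b ^ 2 * Real.cos t ^ 2) * Real.tan d ^ 2 +
      2 * ((b ^ 2 - a ^ 2) * (Real.sin t * Real.cos t)) * Real.tan d -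
        (1 - a ^ 2 * Real.cos t ^ 2 - b ^ 2 * Real.sin t ^ 2) = 0 := by
  rw [Real.cos_add, Real.sin_add, Real.tan_eq_sin_div_cos]
  field_simp
  constructor <;> intro h <;> linear_combination h

/-- The chord from angle `t` to angle `t + 2 d` touches the ellipse. -/
lemma tangency (h : IsAxes a b) (t : ℝ) :
    a ^ 2 * Real.cos (t + Real.arctan (chordTan a b t)) ^ 2 +
      b ^ 2 * Real.sin (t + Real.arctan (chordTan a b t)) ^ 2 =
        Real.cos (Real.arctan (chordTan a b t)) ^ 2 := by
  rw [tangency_iff_quadratic (Real.cos_arctan_pos _).ne', Real.tan_arctan]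
  exact h.chordTan_quadratic t

lemma eq_arctan_of_tangency (h : IsAxes a b) {t d : ℝ} (h0 : 0 < d) (h1 : d < Real.pi / 2)
    (ht : a ^ 2 * Real.cos (t + d) ^ 2 + b ^ 2 * Real.sin (t + d) ^ 2 = Real.cos d ^ 2) :
    d = Real.arctan (chordTan a b t) := by
  have hc : 0 < Real.cos d := Real.cos_pos_of_mem_Ioo ⟨by linarith, h1⟩
  rw [tangency_iff_quadratic hc.ne'] at ht
  have hT := Real.tan_pos_of_pos_of_lt_pi_div_two h0 h1
  have hq := h.chordTan_quadratic t
  have hU := h.chordTan_pos t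
  have hp := h.den_pos t
  have hr := h.const_pos t
  rw [← Real.arctan_tan (by linarith) h1]
  congr 1
  generalize chordTan a b t = U at *
  generalize Real.tan d = T at *
  generalize a ^ 2 * Real.sin t ^ 2 + b ^ 2 * Real.cos t ^ 2 = p at *
  generalize (b ^ 2 - a ^ 2) * (Real.sin t * Real.cos t) = q at *
  generalize 1 - a ^ 2 * Real.cos t ^ 2 - b ^ 2 * Real.sin t ^ 2 = r at *
  -- Eliminating the middle coefficient between the equations of T and U leaves T - U as a factor;
  -- the cofactor is positive since both roots are.
  have h3 : (T - U) * (p * T * U + r) = 0 := by linear_combination U * ht - T * hq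
  have h4 : 0 < p * T * U + r := by positivity
  rcases mul_eq_zero.mp h3 with h5 | h5
  · linarith
  · exact absurd h5 h4.ne'

lemma lt_chordMap (h : IsAxes a b) (t : ℝ) : t < chordMap a b t := by
  have := Real.arctan_pos.mpr (h.chordTan_pos t)
  rw [chordMap]; linarith

lemma chordMap_lt (t : ℝ) : chordMap a b t < t + Real.pi := by
  have := Real.arctan_lt_pi_div_two (chordTan a b t)
  rw [chordMap]; linarith

/-- Rewrites tangency in the two end points alone. The result is symmetric in them, which is the
source of both the reversibility and the invariant density. -/
lemma tangency_bilinear (t d : ℝ) :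
    (1 + b ^ 2 - a ^ 2) * (Real.cos t * Real.cos (t + 2 * d)) +
      (1 - b ^ 2 + a ^ 2) * (Real.sin t * Real.sin (t + 2 * d)) - (a ^ 2 + b ^ 2 - 1) =
    2 * (Real.cos d ^ 2 - (a ^ 2 * Real.cos (t + d) ^ 2 + b ^ 2 * Real.sin (t + d) ^ 2)) := by
  have h1 : t = (t + d) - d := by ring
  have h2 : t + 2 * d = (t + d) + d := by ring
  rw [h2]
  nth_rewrite 1 [h1]
  nth_rewrite 3 [h1]
  generalize t + d = s
  rw [Real.cos_sub, Real.cos_add, Real.sin_sub, Real.sin_add]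
  have hs : Real.sin s ^ 2 = 1 - Real.cos s ^ 2 := by linarith [Real.sin_sq_add_cos_sq s]
  have hd : Real.sin d ^ 2 = 1 - Real.cos d ^ 2 := by linarith [Real.sin_sq_add_cos_sq d]
  linear_combination (1 + b ^ 2 - a ^ 2) * (- Real.sin s ^ 2 * hd - (1 - Real.cos d ^ 2) * hs) +
    (1 - b ^ 2 + a ^ 2) * (Real.cos d ^ 2 * hs - Real.cos s ^ 2 * hd) + 2 * b ^ 2 * hs

lemma chordMap_relation (h : IsAxes a b) (t : ℝ) :
    (1 + b ^ 2 - a ^ 2) * (Real.cos t * Real.cos (chordMap a b t)) +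
      (1 - b ^ 2 + a ^ 2) * (Real.sin t * Real.sin (chordMap a b t)) = a ^ 2 + b ^ 2 - 1 := by
  have := tangency_bilinear (a := a) (b := b) t (Real.arctan (chordTan a b t))
  rw [h.tangency t] at this
  rw [chordMap]; linarith

/-- The relation also holds for the other tangent chord; the window (t, t + π) selects the one with
the ellipse on its left. This is how all explicit values of `chordMap` are computed. -/
lemma chordMap_eq (h : IsAxes a b) {t u : ℝ} (h0 : t < u) (h1 : u < t + Real.pi)
    (hr : (1 + b ^ 2 - a ^ 2) * (Real.cos t * Real.cos u) +
      (1 - b ^ 2 + a ^ 2) * (Real.sin t * Real.sin u) = a ^ 2 + b ^ 2 - 1) :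
    chordMap a b t = u := by
  have h2 : u = t + 2 * ((u - t) / 2) := by ring
  rw [h2] at hr
  have h3 := tangency_bilinear (a := a) (b := b) t ((u - t) / 2)
  rw [chordMap, ← h.eq_arctan_of_tangency (t := t) (d := (u - t) / 2) (by linarith) (by linarith)
    (by linarith)]
  ring

lemma chordMap_add_pi (t : ℝ) : chordMap a b (t + Real.pi) = chordMap a b t + Real.pi := by
  simp only [chordMap, chordTan, Real.sin_add_pi, Real.cos_add_pi, neg_sq, neg_mul_neg]
  ring

lemma chordMap_add_two_pi (t : ℝ) :
    chordMap a b (t + 2 * Real.pi) = chordMap a b t + 2 * Real.pi := by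
  rw [two_mul, ← add_assoc, chordMap_add_pi, chordMap_add_pi, add_assoc]

/-- Reflection in the horizontal axis preserves both conics and reverses orientation, so it
conjugates the map to its inverse. -/
lemma chordMap_neg_chordMap (h : IsAxes a b) (t : ℝ) : chordMap a b (-chordMap a b t) = -t := by
  refine h.chordMap_eq (by linarith [h.lt_chordMap t]) (by linarith [chordMap_lt (a := a) (b := b) t])
    ?_
  rw [Real.cos_neg, Real.cos_neg, Real.sin_neg, Real.sin_neg]
  linarith [h.chordMap_relation t]

end IsAxes

/-! ### Invariant density and the closure theorem -/

/-- The square of the reciprocal of the invariant density of `chordMap`. -/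
noncomputable def chordWeight (a b t : ℝ) : ℝ :=
  ((1 + b ^ 2 - a ^ 2) * Real.cos t) ^ 2 + ((1 - b ^ 2 + a ^ 2) * Real.sin t) ^ 2 -
    (a ^ 2 + b ^ 2 - 1) ^ 2

namespace IsAxes

variable {a b : ℝ}

lemma chordWeight_pos (h : IsAxes a b) (t : ℝ) : 0 < chordWeight a b t := by
  have h1 : chordWeight a b t =
      4 * (a ^ 2 * Real.sin t ^ 2 + b ^ 2 * Real.cos t ^ 2 - a ^ 2 * b ^ 2) := by
    have hc : Real.cos t ^ 2 = 1 - Real.sin t ^ 2 := by linarith [Real.sin_sq_add_cos_sq t]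
    rw [chordWeight, mul_pow, mul_pow, hc]; ring
  rw [h1]
  linarith [h.disc_pos t]

lemma differentiable_chordMap (h : IsAxes a b) : Differentiable ℝ (chordMap a b) := by
  unfold chordMap chordTan
  intro t
  have h1 := (h.disc_pos t).ne'
  have h2 := (h.den_pos t).ne'
  refine differentiableAt_id.add (DifferentiableAt.const_mul (DifferentiableAt.arctan ?_) 2)
  fun_prop (disch := assumption)

/-- The chord touches the ellipse between its end points. -/
lemma tangent_point_inside (h : IsAxes a b) {s d : ℝ} (hs : 0 < Real.sin d) (hc : 0 < Real.cos d)
    (ht : a ^ 2 * Real.cos s ^ 2 + b ^ 2 * Real.sin s ^ 2 = Real.cos d ^ 2) :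
    |(b ^ 2 - a ^ 2) * (Real.sin s * Real.cos s)| < Real.sin d * Real.cos d := by
  refine abs_lt_of_sq_lt_sq ?_ (mul_pos hs hc).le
  have hx : Real.cos s ^ 2 = 1 - Real.sin s ^ 2 := by linarith [Real.sin_sq_add_cos_sq s]
  have hd : Real.sin d ^ 2 = 1 - Real.cos d ^ 2 := by linarith [Real.sin_sq_add_cos_sq d]
  have h1 := combo_pos (mul_pos (pow_pos h.pos' 2) (sub_pos.mpr h.sq_lt_one'))
    (mul_pos (pow_pos h.pos 2) (sub_pos.mpr h.sq_lt_one)) s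
  rw [mul_pow, mul_pow, mul_pow, hd, ← ht]
  rw [hx] at h1 ⊢
  nlinarith

lemma hasDerivAt_chordMap (h : IsAxes a b) (t : ℝ) :
    HasDerivAt (chordMap a b) (√(chordWeight a b (chordMap a b t)) / √(chordWeight a b t)) t := by
  have hF := (h.differentiable_chordMap t).hasDerivAt
  set u := chordMap a b t with hu
  set D := deriv (chordMap a b) t
  have hE := ((((Real.hasDerivAt_cos t).mul hF.cos).const_mul (1 + b ^ 2 - a ^ 2)).add
    (((Real.hasDerivAt_sin t).mul hF.sin).const_mul (1 - b ^ 2 + a ^ 2)))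
  have hconst : HasDerivAt (fun _ : ℝ => a ^ 2 + b ^ 2 - 1) 0 t := hasDerivAt_const t _
  have heq := hE.unique (hconst.congr_of_eventuallyEq
    (Filter.Eventually.of_forall fun x => h.chordMap_relation x))
  have hrel := h.chordMap_relation t
  rw [← hu] at heq hrel
  set d := Real.arctan (chordTan a b t) with hd
  have hud : u = (t + d) + d := by rw [hu, chordMap]; ring
  have hcos : 0 < Real.cos d := Real.cos_arctan_pos _
  have hsin : 0 < Real.sin d := Real.sin_pos_of_pos_of_lt_pi
    (Real.arctan_pos.mpr (h.chordTan_pos t)) (by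
      linarith [Real.arctan_lt_pi_div_two (chordTan a b t), Real.pi_pos])
  have hin := abs_lt.mp (h.tangent_point_inside hsin hcos (h.tangency t))
  rw [← hd] at hin
  have hsub : Real.cos t * Real.sin u - Real.sin t * Real.cos u =
      2 * (Real.sin d * Real.cos d) := by
    have : Real.sin (u - t) = 2 * Real.sin d * Real.cos d := by
      rw [← Real.sin_two_mul]; congr 1; rw [hud]; ring
    rw [Real.sin_sub] at this; linarith
  have hadd : Real.cos t * Real.sin u + Real.sin t * Real.cos u =
      2 * (Real.sin (t + d) * Real.cos (t + d)) := by
    have : Real.sin (u + t) = 2 * Real.sin (t + d) * Real.cos (t + d) := by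
      rw [← Real.sin_two_mul]; congr 1; rw [hud]; ring
    rw [Real.sin_add] at this; linarith
  have hk := congrArg ((b ^ 2 - a ^ 2) * ·) hadd
  beta_reduce at hk
  -- By (A cos t sin u - B sin t cos u)² + (A cos t cos u + B sin t sin u)² = A² cos² t + B² sin² t,
  -- the partial derivative of the relation in u is a square root of the weight up to sign. The sign
  -- comes from `tangent_point_inside`.
  have h1 : √(chordWeight a b t) = (1 + b ^ 2 - a ^ 2) * (Real.cos t * Real.sin u) -
      (1 - b ^ 2 + a ^ 2) * (Real.sin t * Real.cos u) := by
    refine (Real.sqrt_eq_iff_mul_self_eq (h.chordWeight_pos t).le (by linarith)).mpr ?_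
    rw [chordWeight, ← hrel]
    have hx : Real.sin u ^ 2 = 1 - Real.cos u ^ 2 := by linarith [Real.sin_sq_add_cos_sq u]
    linear_combination -((1 + b ^ 2 - a ^ 2) ^ 2 * Real.cos t ^ 2 +
      (1 - b ^ 2 + a ^ 2) ^ 2 * Real.sin t ^ 2) * hx
  have h2 : √(chordWeight a b u) = - (1 + b ^ 2 - a ^ 2) * (Real.sin t * Real.cos u) +
      (1 - b ^ 2 + a ^ 2) * (Real.cos t * Real.sin u) := by
    refine (Real.sqrt_eq_iff_mul_self_eq (h.chordWeight_pos u).le (by linarith)).mpr ?_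
    rw [chordWeight, ← hrel]
    have hx : Real.sin t ^ 2 = 1 - Real.cos t ^ 2 := by linarith [Real.sin_sq_add_cos_sq t]
    linear_combination -((1 + b ^ 2 - a ^ 2) ^ 2 * Real.cos u ^ 2 +
      (1 - b ^ 2 + a ^ 2) ^ 2 * Real.sin u ^ 2) * hx
  have h3 : D = √(chordWeight a b u) / √(chordWeight a b t) := by
    rw [eq_div_iff (Real.sqrt_pos.mpr (h.chordWeight_pos t)).ne', h1, h2]
    linear_combination -heq
  rw [← h3]; exact hF

lemma strictMono_chordMap (h : IsAxes a b) : StrictMono (chordMap a b) :=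
  strictMono_of_deriv_pos fun t => by
    rw [(h.hasDerivAt_chordMap t).deriv]
    exact div_pos (Real.sqrt_pos.mpr (h.chordWeight_pos _)) (Real.sqrt_pos.mpr (h.chordWeight_pos _))

/-- The elliptic integral which conjugates `chordMap` to a translation. -/
noncomputable def _root_.chordCoord (a b t : ℝ) : ℝ :=
  ∫ x in (0 : ℝ)..t, (√(chordWeight a b x))⁻¹

lemma hasDerivAt_chordCoord (h : IsAxes a b) (t : ℝ) :
    HasDerivAt (chordCoord a b) (√(chordWeight a b t))⁻¹ t := by
  have hc : Continuous fun x => (√(chordWeight a b x))⁻¹ := by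
    refine Continuous.inv₀ ?_ fun x => (Real.sqrt_pos.mpr (h.chordWeight_pos x)).ne'
    unfold chordWeight; fun_prop
  exact intervalIntegral.integral_hasDerivAt_right (hc.intervalIntegrable _ _)
    (hc.stronglyMeasurableAtFilter _ _) hc.continuousAt

lemma strictMono_chordCoord (h : IsAxes a b) : StrictMono (chordCoord a b) :=
  strictMono_of_deriv_pos fun t => by
    rw [(h.hasDerivAt_chordCoord t).deriv]
    exact inv_pos.mpr (Real.sqrt_pos.mpr (h.chordWeight_pos t))

lemma _root_.sub_eq_of_hasDerivAt_eq {f g f' : ℝ → ℝ} (hf : ∀ x, HasDerivAt f (f' x) x)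
    (hg : ∀ x, HasDerivAt g (f' x) x) (x y : ℝ) : f x - g x = f y - g y :=
  is_const_of_deriv_eq_zero (f := fun x => f x - g x)
    (fun x => ((hf x).sub (hg x)).differentiableAt)
    (fun x => (((hf x).sub (hg x)).congr_deriv (sub_self _)).deriv) x y

/-- Both sides have derivative 1/√W in t: the derivative of `chordMap` cancels the weight at the
image point. -/
lemma chordCoord_chordMap (h : IsAxes a b) (t : ℝ) :
    chordCoord a b (chordMap a b t) = chordCoord a b t + chordCoord a b (chordMap a b 0) := by
  have h0 : chordCoord a b 0 = 0 := intervalIntegral.integral_same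
  have h1 : ∀ x, HasDerivAt (fun x => chordCoord a b (chordMap a b x))
      (√(chordWeight a b x))⁻¹ x := fun x => by
    refine ((h.hasDerivAt_chordCoord (chordMap a b x)).comp x
      (h.hasDerivAt_chordMap x)).congr_deriv ?_
    rw [div_eq_mul_inv, inv_mul_cancel_left₀
      (Real.sqrt_pos.mpr (h.chordWeight_pos (chordMap a b x))).ne']
  have := sub_eq_of_hasDerivAt_eq h1 h.hasDerivAt_chordCoord t 0
  linarith

lemma chordCoord_add_two_pi (h : IsAxes a b) (t : ℝ) :
    chordCoord a b (t + 2 * Real.pi) = chordCoord a b t + chordCoord a b (2 * Real.pi) := by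
  have h0 : chordCoord a b 0 = 0 := intervalIntegral.integral_same
  have h1 : ∀ x, HasDerivAt (fun x => chordCoord a b (x + 2 * Real.pi))
      (√(chordWeight a b x))⁻¹ x := fun x => by
    have := (h.hasDerivAt_chordCoord (x + 2 * Real.pi)).comp_add_const x (2 * Real.pi)
    simpa [chordWeight] using this
  have := sub_eq_of_hasDerivAt_eq h1 h.hasDerivAt_chordCoord t 0
  rw [zero_add] at this
  linarith

/-- Poncelet's closure theorem: if one polygon closes up after one turn, so do all of them. -/
lemma iterate_chordMap_eq (h : IsAxes a b) {n : ℕ} {x : ℝ}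
    (hx : (chordMap a b)^[n] x = x + 2 * Real.pi) (y : ℝ) :
    (chordMap a b)^[n] y = y + 2 * Real.pi := by
  have h1 : ∀ (n : ℕ) (t : ℝ), chordCoord a b ((chordMap a b)^[n] t) =
      chordCoord a b t + n * chordCoord a b (chordMap a b 0) := by
    intro n
    induction n with
    | zero => intro t; simp
    | succ n ih =>
      intro t
      rw [Function.iterate_succ_apply', h.chordCoord_chordMap, ih]; push_cast; ring
  apply h.strictMono_chordCoord.injective
  have h2 := h1 n x
  rw [hx, h.chordCoord_add_two_pi] at h2
  rw [h1, h.chordCoord_add_two_pi]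
  linarith

/-! ### Symmetric orbits: closure after four, three and six steps -/

lemma chordMap_eq_pi_sub (h : IsAxes a b) {x y : ℝ} (hxy : chordMap a b x = y) :
    chordMap a b (Real.pi - y) = Real.pi - x := by
  have := h.chordMap_neg_chordMap x
  rw [hxy] at this
  rw [sub_eq_neg_add, chordMap_add_pi, this]; ring

lemma chordMap_eq_two_pi_sub (h : IsAxes a b) {x y : ℝ} (hxy : chordMap a b x = y) :
    chordMap a b (2 * Real.pi - y) = 2 * Real.pi - x := by
  have := h.chordMap_neg_chordMap x
  rw [hxy] at this
  rw [sub_eq_neg_add, chordMap_add_two_pi, this]; ring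

lemma chordMap_pi : chordMap a b Real.pi = Real.pi + chordMap a b 0 := by
  have := chordMap_add_pi (a := a) (b := b) 0
  rw [zero_add] at this
  rw [this, add_comm]

lemma coeff_pos (h : IsAxes a b) : 0 < 1 + b ^ 2 - a ^ 2 := by
  nlinarith [h.sq_lt_one, sq_nonneg b]

lemma iterate_four_iff (h : IsAxes a b) :
    (chordMap a b)^[4] 0 = 2 * Real.pi ↔ a ^ 2 + b ^ 2 = 1 := by
  have hrel := h.chordMap_relation 0
  simp only [Real.cos_zero, Real.sin_zero] at hrel
  simp only [Function.iterate_succ, Function.iterate_zero, Function.comp, id]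
  constructor
  · intro h4
    have hi := h.strictMono_chordMap.injective
    have e2 := h.chordMap_eq_two_pi_sub (x := 0) rfl
    have e3 := h.chordMap_eq_two_pi_sub (x := chordMap a b 0) rfl
    -- The reflected orbit also reaches 2π in two more steps, so by injectivity the second vertex is
    -- its own mirror image, namely π.
    have e4 : 2 * Real.pi - chordMap a b (chordMap a b 0) = chordMap a b (chordMap a b 0) := by
      apply hi; apply hi; rw [e3, e2, h4, sub_zero]
    have e5 := h.chordMap_eq_pi_sub (x := 0) rfl
    have e6 : Real.pi - chordMap a b 0 = chordMap a b 0 := by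
      apply hi; rw [e5]; linarith
    have e7 : chordMap a b 0 = Real.pi / 2 := by linarith
    rw [e7, Real.cos_pi_div_two] at hrel
    linarith
  · intro hab
    have e0 : chordMap a b 0 = Real.pi / 2 := by
      refine h.chordMap_eq (by linarith [Real.pi_pos]) (by linarith [Real.pi_pos]) ?_
      rw [Real.cos_pi_div_two, Real.sin_zero]; linarith
    have e1 : chordMap a b (Real.pi / 2) = Real.pi := by
      have := h.chordMap_eq_pi_sub e0
      rwa [sub_half, sub_zero] at this
    rw [e0, e1, chordMap_pi, e0, add_comm, chordMap_add_pi, e1]; ring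

lemma iterate_three_iff (h : IsAxes a b) :
    (chordMap a b)^[3] 0 = 2 * Real.pi ↔ a + b = 1 := by
  have hi := h.strictMono_chordMap.injective
  have hrel := h.chordMap_relation 0
  simp only [Function.iterate_succ, Function.iterate_zero, Function.comp, id]
  have hp := h.pos
  have hp' := h.pos'
  have hl := h.lt
  have hl1 := h.lt_one
  have hA := h.coeff_pos
  constructor
  · intro h3
    have e1 := h.chordMap_eq_two_pi_sub (x := 0) rfl
    have e2 : chordMap a b (chordMap a b 0) = 2 * Real.pi - chordMap a b 0 := by
      apply hi; rw [h3, e1, sub_zero]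
    have hrel2 := h.chordMap_relation (chordMap a b 0)
    rw [e2, Real.cos_two_pi_sub, Real.sin_two_pi_sub] at hrel2
    simp only [Real.cos_zero, Real.sin_zero] at hrel
    have hs : Real.sin (chordMap a b 0) ^ 2 = 1 - Real.cos (chordMap a b 0) ^ 2 := by
      linarith [Real.sin_sq_add_cos_sq (chordMap a b 0)]
    generalize Real.cos (chordMap a b 0) = x at *
    generalize Real.sin (chordMap a b 0) = y at *
    -- The side from u to 2π - u is vertical and tangent, so its abscissa is ±a. The value a is
    -- excluded below by positivity, because 0 < a < b < 1.
    have h4 : x ^ 2 = a ^ 2 := by linear_combination hrel2 / 2 + (1 - b ^ 2 + a ^ 2) / 2 * hs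
    rcases sq_eq_sq_iff_eq_or_eq_neg.mp h4 with h5 | h5
    · rw [h5] at hrel
      have h6 : (1 - a) * ((1 + a - b) * (1 + a + b)) = 0 := by linear_combination hrel
      have : 0 < (1 - a) * ((1 + a - b) * (1 + a + b)) :=
        mul_pos (by linarith) (mul_pos (by linarith) (by linarith))
      linarith
    · rw [h5] at hrel
      have h6 : (1 + a) * ((a + b - 1) * (1 - a + b)) = 0 := by linear_combination -hrel
      have h7 : (1 + a) ≠ 0 := by linarith
      have h8 : (1 - a + b) ≠ 0 := by linarith
      have := (mul_eq_zero.mp ((mul_eq_zero.mp h6).resolve_left h7)).resolve_right h8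
      linarith
  · intro hab
    obtain rfl : b = 1 - a := by linarith
    have hcos : Real.cos (Real.arccos (-a)) = -a := Real.cos_arccos (by linarith) (by linarith)
    have hlo : Real.pi / 2 < Real.arccos (-a) := by
      rw [← Real.arccos_zero]; exact Real.arccos_lt_arccos (by linarith) (by linarith) (by linarith)
    have hhi : Real.arccos (-a) < Real.pi := by
      rw [← Real.arccos_neg_one]
      exact Real.arccos_lt_arccos (by linarith) (by linarith) (by linarith)
    have hs : Real.sin (Real.arccos (-a)) ^ 2 = 1 - a ^ 2 := by
      have := Real.sin_sq_add_cos_sq (Real.arccos (-a)); rw [hcos] at this; linarith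
    have hpi := Real.pi_pos
    have e0 : chordMap a (1 - a) 0 = Real.arccos (-a) := by
      refine h.chordMap_eq (by linarith) (by linarith) ?_
      rw [hcos, Real.sin_zero, Real.cos_zero]; ring
    have e1 : chordMap a (1 - a) (Real.arccos (-a)) = 2 * Real.pi - Real.arccos (-a) := by
      refine h.chordMap_eq (by linarith) (by linarith) ?_
      rw [Real.cos_two_pi_sub, Real.sin_two_pi_sub, hcos]
      linear_combination (-(1 - (1 - a) ^ 2 + a ^ 2)) * hs
    rw [e0, e1, h.chordMap_eq_two_pi_sub e0, sub_zero]

lemma iterate_six_iff (h : IsAxes a b) :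
    (chordMap a b)^[6] 0 = 2 * Real.pi ↔ √(1 - a ^ 2) + √(1 - b ^ 2) = 1 := by
  have hi := h.strictMono_chordMap.injective
  have hrel := h.chordMap_relation 0
  simp only [Function.iterate_succ, Function.iterate_zero, Function.comp, id]
  have hA := h.coeff_pos
  have hp0 : 0 < √(1 - a ^ 2) := Real.sqrt_pos.mpr (sub_pos.mpr h.sq_lt_one)
  have hq0 : 0 < √(1 - b ^ 2) := Real.sqrt_pos.mpr (sub_pos.mpr h.sq_lt_one')
  have hp2 : √(1 - a ^ 2) ^ 2 = 1 - a ^ 2 := Real.sq_sqrt (sub_pos.mpr h.sq_lt_one).le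
  have hq2 : √(1 - b ^ 2) ^ 2 = 1 - b ^ 2 := Real.sq_sqrt (sub_pos.mpr h.sq_lt_one').le
  have hpi := Real.pi_pos
  have hqlt : √(1 - b ^ 2) < 1 := by nlinarith [pow_pos h.pos' 2]
  generalize √(1 - a ^ 2) = p at *
  generalize √(1 - b ^ 2) = q at *
  constructor
  · intro h6
    have e2 := h.chordMap_eq_two_pi_sub (x := 0) rfl
    have e3 := h.chordMap_eq_two_pi_sub (x := chordMap a b 0) rfl
    have e4 := h.chordMap_eq_two_pi_sub (x := chordMap a b (chordMap a b 0)) rfl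
    have e5 : 2 * Real.pi - chordMap a b (chordMap a b (chordMap a b 0)) =
        chordMap a b (chordMap a b (chordMap a b 0)) := by
      apply hi; apply hi; apply hi; rw [e4, e3, e2, h6, sub_zero]
    have e6 := h.chordMap_eq_pi_sub (x := 0) rfl
    -- The third vertex is π by `e5`; the symmetry in the vertical axis then exchanges the first and
    -- second vertices.
    have e7 : chordMap a b (chordMap a b 0) = Real.pi - chordMap a b 0 := by
      apply hi; rw [e6]; linarith
    have hrel2 := h.chordMap_relation (chordMap a b 0)
    have hlt := h.lt_chordMap (chordMap a b 0)
    have hlt0 := h.lt_chordMap 0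
    rw [e7, Real.cos_pi_sub, Real.sin_pi_sub] at hrel2
    rw [e7] at hlt
    have hcos : 0 < Real.cos (chordMap a b 0) :=
      Real.cos_pos_of_mem_Ioo ⟨by linarith, by linarith⟩
    simp only [Real.cos_zero, Real.sin_zero] at hrel
    have hs : Real.sin (chordMap a b 0) ^ 2 = 1 - Real.cos (chordMap a b 0) ^ 2 := by
      linarith [Real.sin_sq_add_cos_sq (chordMap a b 0)]
    generalize Real.cos (chordMap a b 0) = x at *
    generalize Real.sin (chordMap a b 0) = y at *
    -- The side from u to π - u is horizontal and tangent, so its height is b up to sign and cos² u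
    -- = 1 - b²; u < π/2 fixes the sign of the cosine.
    have h4 : x ^ 2 = q ^ 2 := by
      linear_combination -hrel2 / 2 + (1 - b ^ 2 + a ^ 2) / 2 * hs - hq2
    have h5 : x = q := by
      rcases sq_eq_sq_iff_eq_or_eq_neg.mp h4 with h5 | h5 <;> linarith
    rw [h5] at hrel
    have h6 : (1 + q) * ((p + q - 1) * (p + 1 - q)) = 0 := by
      linear_combination hrel + (1 + q) * hp2 + (1 - q) * hq2
    have h7 : (1 + q) ≠ 0 := by linarith
    have h8 : (p + 1 - q) ≠ 0 := by linarith
    have := (mul_eq_zero.mp ((mul_eq_zero.mp h6).resolve_left h7)).resolve_right h8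
    linarith
  · intro hab
    obtain rfl : p = 1 - q := by linarith
    have hcos : Real.cos (Real.arccos q) = q := Real.cos_arccos (by linarith) (by linarith)
    have hlo : Real.arccos q < Real.pi / 2 := by
      rw [← Real.arccos_zero]; exact Real.arccos_lt_arccos (by linarith) (by linarith) (by linarith)
    have hhi : 0 < Real.arccos q := by
      rw [← Real.arccos_one]
      exact Real.arccos_lt_arccos (by linarith) (by linarith) (by linarith)
    have hs : Real.sin (Real.arccos q) ^ 2 = 1 - q ^ 2 := by
      have := Real.sin_sq_add_cos_sq (Real.arccos q); rw [hcos] at this; linarith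
    have e0 : chordMap a b 0 = Real.arccos q := by
      refine h.chordMap_eq (by linarith) (by linarith) ?_
      rw [hcos, Real.sin_zero, Real.cos_zero]
      linear_combination -(1 + q) * hp2 - (1 - q) * hq2
    have e1 : chordMap a b (Real.arccos q) = Real.pi - Real.arccos q := by
      refine h.chordMap_eq (by linarith) (by linarith) ?_
      rw [Real.cos_pi_sub, Real.sin_pi_sub, hcos]
      linear_combination (1 - b ^ 2 + a ^ 2) * hs - 2 * hq2
    have e2 : chordMap a b (Real.pi - Real.arccos q) = Real.pi := by
      rw [h.chordMap_eq_pi_sub e0, sub_zero]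
    rw [e0, e1, e2, chordMap_pi, e0, add_comm Real.pi, chordMap_add_pi, e1, chordMap_add_pi, e2]
    ring

end IsAxes

/-! ### The translation number of the normal form -/

namespace IsAxes

variable {a b : ℝ}

/-- `chordMap` with angles measured in full turns. -/
noncomputable def turnMap (h : IsAxes a b) : CircleDeg1Lift where
  toFun t := chordMap a b (2 * Real.pi * t) / (2 * Real.pi)
  monotone' := fun x y hxy => by
    have := h.strictMono_chordMap.monotone
      (mul_le_mul_of_nonneg_left hxy Real.two_pi_pos.le)
    exact div_le_div_of_nonneg_right this Real.two_pi_pos.le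
  map_add_one' := fun x => by
    rw [mul_add, mul_one, chordMap_add_two_pi, add_div, div_self Real.two_pi_pos.ne']

lemma turnMap_apply (h : IsAxes a b) (t : ℝ) :
    h.turnMap t = chordMap a b (2 * Real.pi * t) / (2 * Real.pi) := rfl

lemma two_pi_mul_turnMap (h : IsAxes a b) (t : ℝ) :
    2 * Real.pi * h.turnMap t = chordMap a b (2 * Real.pi * t) := by
  rw [turnMap_apply, mul_div_cancel₀ _ Real.two_pi_pos.ne']

lemma continuous_turnMap (h : IsAxes a b) : Continuous h.turnMap :=
  (h.differentiable_chordMap.continuous.comp (continuous_const.mul continuous_id)).div_const _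

lemma two_pi_mul_iterate_turnMap (h : IsAxes a b) (n : ℕ) (t : ℝ) :
    2 * Real.pi * h.turnMap^[n] t = (chordMap a b)^[n] (2 * Real.pi * t) := by
  induction n with
  | zero => rfl
  | succ n ih => rw [Function.iterate_succ_apply', Function.iterate_succ_apply',
      two_pi_mul_turnMap, ih]

lemma fract_translationNumber_turnMap (h : IsAxes a b) :
    Int.fract (CircleDeg1Lift.translationNumber h.turnMap) =
      CircleDeg1Lift.translationNumber h.turnMap := by
  have hpi := Real.two_pi_pos
  rw [Int.fract_eq_self]
  -- Each step advances by more than zero and less than half a turn, so reduction modulo one changes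
  -- nothing.
  constructor
  · refine CircleDeg1Lift.le_translationNumber_of_add_le _ fun x => ?_
    rw [add_zero, turnMap_apply, le_div_iff₀ hpi, mul_comm]
    exact (h.lt_chordMap _).le
  · refine (CircleDeg1Lift.translationNumber_le_of_le_add (z := 1 / 2) _ fun x => ?_).trans_lt
      (by norm_num)
    rw [turnMap_apply, div_le_iff₀ hpi]
    linarith [chordMap_lt (a := a) (b := b) (2 * Real.pi * x)]

lemma translationNumber_turnMap_eq_iff (h : IsAxes a b) {n : ℕ} (hn : 0 < n) :
    CircleDeg1Lift.translationNumber h.turnMap = 1 / n ↔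
      (chordMap a b)^[n] 0 = 2 * Real.pi := by
  have hpi := Real.two_pi_pos
  have := CircleDeg1Lift.translationNumber_eq_rat_iff _ h.continuous_turnMap (m := 1) hn
  rw [Int.cast_one] at this
  rw [this]
  simp only [CircleDeg1Lift.coe_pow]
  constructor
  · rintro ⟨x, hx⟩
    have h1 := h.two_pi_mul_iterate_turnMap n x
    rw [hx, mul_add, mul_one] at h1
    rw [h.iterate_chordMap_eq h1.symm, zero_add]
  · intro h0
    refine ⟨0, ?_⟩
    have h1 := h.two_pi_mul_iterate_turnMap n 0
    rw [mul_zero, h0] at h1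
    rw [zero_add]
    exact mul_left_cancel₀ hpi.ne' (h1.trans (mul_one _).symm)

end IsAxes

/-! ### Polar angle of a plane curve -/

lemma Real.exists_int_of_cos_eq_of_sin_eq {x y : ℝ} (hc : Real.cos x = Real.cos y)
    (hs : Real.sin x = Real.sin y) : ∃ n : ℤ, x = y + n * (2 * Real.pi) := by
  obtain ⟨k, hk⟩ := Real.Angle.angle_eq_iff_two_pi_dvd_sub.mp (Real.Angle.cos_sin_inj hc hs)
  exact ⟨k, by linarith⟩

/-- A plane curve which turns counterclockwise around the origin has a differentiable polar
angle. -/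
lemma exists_polar_angle {X Y X' Y' : ℝ → ℝ} (hX : ∀ t, HasDerivAt X (X' t) t)
    (hY : ∀ t, HasDerivAt Y (Y' t) t) (hX' : Continuous X') (hY' : Continuous Y')
    (hpos : ∀ t, 0 < X t * Y' t - Y t * X' t) :
    ∃ θ : ℝ → ℝ, (∀ t, HasDerivAt θ ((X t * Y' t - Y t * X' t) / (X t ^ 2 + Y t ^ 2)) t) ∧
      ∀ t, X t = √(X t ^ 2 + Y t ^ 2) * Real.cos (θ t) ∧
        Y t = √(X t ^ 2 + Y t ^ 2) * Real.sin (θ t) := by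
  have hcX : Continuous X := continuous_iff_continuousAt.mpr fun t => (hX t).continuousAt
  have hcY : Continuous Y := continuous_iff_continuousAt.mpr fun t => (hY t).continuousAt
  have hR : ∀ t, 0 < X t ^ 2 + Y t ^ 2 := fun t => by
    by_contra hn
    have h1 : X t = 0 := by nlinarith [sq_nonneg (X t), sq_nonneg (Y t)]
    have h2 : Y t = 0 := by nlinarith [sq_nonneg (X t), sq_nonneg (Y t)]
    have := hpos t
    rw [h1, h2] at this
    simp at this
  set f : ℝ → ℝ := fun t => (X t * Y' t - Y t * X' t) / (X t ^ 2 + Y t ^ 2) with hf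
  have hfc : Continuous f := by
    refine Continuous.div ?_ ?_ fun t => (hR t).ne' <;> fun_prop
  set z : ℂ := ⟨X 0, Y 0⟩ with hz
  -- The angular velocity is integrated from the argument at time 0.
  set θ : ℝ → ℝ := fun t => z.arg + ∫ x in (0 : ℝ)..t, f x with hθ
  have hθ' : ∀ t, HasDerivAt θ (f t) t := fun t =>
    (intervalIntegral.integral_hasDerivAt_right (hfc.intervalIntegrable _ _)
      (hfc.stronglyMeasurableAtFilter _ _) hfc.continuousAt).const_add _
  have hθ0 : θ 0 = z.arg := by simp [hθ]
  have hS : ∀ t, HasDerivAt (fun t => √(X t ^ 2 + Y t ^ 2))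
      ((X t * X' t + Y t * Y' t) / √(X t ^ 2 + Y t ^ 2)) t := fun t => by
    refine ((((hX t).pow 2).add ((hY t).pow 2)).sqrt (hR t).ne').congr_deriv ?_
    have := (Real.sqrt_pos.mpr (hR t)).ne'
    simp only [Pi.add_apply, Pi.pow_apply]
    field_simp
    ring
  -- The two quotients here and in `hV` are the coordinates of the normalized curve in the frame
  -- rotated by θ. They are constant, hence always (1, 0).
  have hU : ∀ t, HasDerivAt (fun t => (X t * Real.cos (θ t) + Y t * Real.sin (θ t)) /
      √(X t ^ 2 + Y t ^ 2)) 0 t := fun t => by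
    have h0 := (Real.sqrt_pos.mpr (hR t)).ne'
    refine ((((hX t).mul (hθ' t).cos).add ((hY t).mul (hθ' t).sin)).div (hS t) h0).congr_deriv ?_
    have h2 := Real.sq_sqrt (hR t).le
    simp only [Pi.add_apply, Pi.mul_apply, hf]
    generalize √(X t ^ 2 + Y t ^ 2) = S at *
    rw [← h2, div_eq_zero_iff]
    left
    field_simp
    rw [h2]
    ring
  have hV : ∀ t, HasDerivAt (fun t => (Y t * Real.cos (θ t) - X t * Real.sin (θ t)) /
      √(X t ^ 2 + Y t ^ 2)) 0 t := fun t => by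
    have h0 := (Real.sqrt_pos.mpr (hR t)).ne'
    refine ((((hY t).mul (hθ' t).cos).sub ((hX t).mul (hθ' t).sin)).div (hS t) h0).congr_deriv ?_
    have h2 := Real.sq_sqrt (hR t).le
    simp only [Pi.sub_apply, Pi.mul_apply, hf]
    generalize √(X t ^ 2 + Y t ^ 2) = S at *
    rw [← h2, div_eq_zero_iff]
    left
    field_simp
    rw [h2]
    ring
  have hzn : ‖z‖ = √(X 0 ^ 2 + Y 0 ^ 2) := by
    rw [Complex.norm_eq_sqrt_sq_add_sq]
  have hX0 : X 0 = √(X 0 ^ 2 + Y 0 ^ 2) * Real.cos (θ 0) := by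
    rw [hθ0, ← hzn, Complex.norm_mul_cos_arg]
  have hY0 : Y 0 = √(X 0 ^ 2 + Y 0 ^ 2) * Real.sin (θ 0) := by
    rw [hθ0, ← hzn, Complex.norm_mul_sin_arg]
  refine ⟨θ, hθ', fun t => ?_⟩
  have hUt := is_const_of_deriv_eq_zero (fun t => (hU t).differentiableAt)
    (fun t => (hU t).deriv) t 0
  have hVt := is_const_of_deriv_eq_zero (fun t => (hV t).differentiableAt)
    (fun t => (hV t).deriv) t 0
  have hs0 := (Real.sqrt_pos.mpr (hR 0)).ne'
  have hst := (Real.sqrt_pos.mpr (hR t)).ne'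
  have hcs0 := Real.sin_sq_add_cos_sq (θ 0)
  have hcst := Real.sin_sq_add_cos_sq (θ t)
  generalize √(X 0 ^ 2 + Y 0 ^ 2) = S0 at *
  have hU0 : (X 0 * Real.cos (θ 0) + Y 0 * Real.sin (θ 0)) / S0 = 1 := by
    rw [div_eq_one_iff_eq hs0, hX0, hY0]; linear_combination S0 * hcs0
  have hV0 : (Y 0 * Real.cos (θ 0) - X 0 * Real.sin (θ 0)) / S0 = 0 := by
    rw [div_eq_zero_iff, hX0, hY0]; left; ring
  rw [hU0, div_eq_one_iff_eq hst] at hUt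
  rw [hV0, div_eq_zero_iff, or_iff_left hst] at hVt
  rw [← hUt]
  constructor
  · linear_combination (-X t) * hcst - Real.sin (θ t) * hVt
  · linear_combination (-Y t) * hcst + Real.cos (θ t) * hVt

/-- A periodic plane curve which turns counterclockwise around the origin, and meets each ray once,
has a polar angle of degree one. -/
lemma exists_polar_angle_of_periodic {X Y X' Y' : ℝ → ℝ} (hX : ∀ t, HasDerivAt X (X' t) t)
    (hY : ∀ t, HasDerivAt Y (Y' t) t) (hX' : Continuous X') (hY' : Continuous Y')
    (hpos : ∀ t, 0 < X t * Y' t - Y t * X' t) (pX : ∀ t, X (t + 2 * Real.pi) = X t)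
    (pY : ∀ t, Y (t + 2 * Real.pi) = Y t) (pX' : ∀ t, X' (t + 2 * Real.pi) = X' t)
    (pY' : ∀ t, Y' (t + 2 * Real.pi) = Y' t)
    (inj : ∀ s t k : ℝ, 0 < k → X s = k * X t → Y s = k * Y t →
      ∃ n : ℤ, s = t + n * (2 * Real.pi)) :
    ∃ θ : ℝ → ℝ, Continuous θ ∧ StrictMono θ ∧ (∀ t, θ (t + 2 * Real.pi) = θ t + 2 * Real.pi) ∧
      ∀ t, ∃ k, 0 < k ∧ X t = k * Real.cos (θ t) ∧ Y t = k * Real.sin (θ t) := by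
  obtain ⟨θ, hd, hp⟩ := exists_polar_angle hX hY hX' hY' hpos
  have hpi := Real.two_pi_pos
  have hR : ∀ t, 0 < X t ^ 2 + Y t ^ 2 := fun t => by
    by_contra hn
    have h1 : X t = 0 := by nlinarith [sq_nonneg (X t), sq_nonneg (Y t)]
    have h2 : Y t = 0 := by nlinarith [sq_nonneg (X t), sq_nonneg (Y t)]
    have := hpos t
    rw [h1, h2] at this
    simp at this
  have hc : Continuous θ := continuous_iff_continuousAt.mpr fun t => (hd t).continuousAt
  have hm : StrictMono θ := strictMono_of_deriv_pos fun t => by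
    rw [(hd t).deriv]; exact div_pos (hpos t) (hR t)
  have hk : ∀ t, 0 < √(X t ^ 2 + Y t ^ 2) := fun t => Real.sqrt_pos.mpr (hR t)
  refine ⟨θ, hc, hm, ?_, fun t => ⟨_, hk t, hp t⟩⟩
  have hd2 : ∀ t, HasDerivAt (fun t => θ (t + 2 * Real.pi))
      ((X t * Y' t - Y t * X' t) / (X t ^ 2 + Y t ^ 2)) t := fun t => by
    have := (hd (t + 2 * Real.pi)).comp_add_const t (2 * Real.pi)
    rwa [pX, pY, pX', pY'] at this
  obtain ⟨n, hn⟩ : ∃ n : ℤ, θ (0 + 2 * Real.pi) = θ 0 + n * (2 * Real.pi) := by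
    have h1 := hp 0
    have h2 := hp (0 + 2 * Real.pi)
    rw [pX, pY] at h2
    exact Real.exists_int_of_cos_eq_of_sin_eq
      (mul_left_cancel₀ (hk 0).ne' (h2.1.symm.trans h1.1))
      (mul_left_cancel₀ (hk 0).ne' (h2.2.symm.trans h1.2))
  have hn0 : (0 : ℝ) < n := by
    have := hm (show (0 : ℝ) < 0 + 2 * Real.pi by linarith)
    rw [hn] at this
    exact (mul_pos_iff_of_pos_right hpi).mp (by linarith)
  -- With two or more turns per period, the curve would meet its initial ray again at a time
  -- strictly inside (0, 2π), against `inj`.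
  have hn1 : n = 1 := by
    have h1 : 0 < n := by exact_mod_cast hn0
    by_contra hne
    have h2 : (2 : ℝ) ≤ n := by exact_mod_cast (show 2 ≤ n by omega)
    obtain ⟨s, hs, hs2⟩ := intermediate_value_Ioo (show (0 : ℝ) ≤ 0 + 2 * Real.pi by linarith)
      hc.continuousOn (show θ 0 + 2 * Real.pi ∈ Set.Ioo (θ 0) (θ (0 + 2 * Real.pi)) from
        ⟨by linarith, by rw [hn]; nlinarith⟩)
    have e0 := hp 0
    have es := hp s
    rw [hs2, Real.cos_add_two_pi, Real.sin_add_two_pi] at es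
    obtain ⟨m, hm⟩ := inj s 0 (√(X s ^ 2 + Y s ^ 2) / √(X 0 ^ 2 + Y 0 ^ 2))
      (div_pos (hk s) (hk 0))
      (by
        have h1 := es.1
        have h2 := e0.1
        have h3 := (hk 0).ne'
        generalize √(X s ^ 2 + Y s ^ 2) = S at *
        generalize √(X 0 ^ 2 + Y 0 ^ 2) = T at *
        rw [h1, h2]; field_simp)
      (by
        have h1 := es.2
        have h2 := e0.2
        have h3 := (hk 0).ne'
        generalize √(X s ^ 2 + Y s ^ 2) = S at *
        generalize √(X 0 ^ 2 + Y 0 ^ 2) = T at *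
        rw [h1, h2]; field_simp)
    have hs1 := hs.1
    have hs3 := hs.2
    rw [hm] at hs1 hs3
    have m0 : (0 : ℝ) < m := (mul_pos_iff_of_pos_right hpi).mp (by linarith)
    have m1 : (m : ℝ) < 1 := by
      by_contra hge
      nlinarith
    have m0' : 0 < m := by exact_mod_cast m0
    have m1' : m < 1 := by exact_mod_cast m1
    omega
  intro t
  have := sub_eq_of_hasDerivAt_eq hd2 hd t 0
  simp only [hn, hn1, Int.cast_one] at this
  linarith

/-! ### Eigenvalues of the pencil and the bicentric case -/

lemma hasEigenvalue_inv_mul_iff {Co Ci : Matrix (Fin 3) (Fin 3) ℝ} (hdet : Co.det ≠ 0) (μ : ℝ) :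
    Module.End.HasEigenvalue (Matrix.toLin' (Co⁻¹ * Ci)) μ ↔
      ∃ v : Fin 3 → ℝ, v ≠ 0 ∧ Ci *ᵥ v = μ • (Co *ᵥ v) := by
  have hu : IsUnit Co.det := isUnit_iff_ne_zero.mpr hdet
  constructor
  · intro h
    obtain ⟨v, hv⟩ := h.exists_hasEigenvector
    refine ⟨v, hv.2, ?_⟩
    have h1 := hv.apply_eq_smul
    rw [Matrix.toLin'_apply] at h1
    have h2 := congrArg (Co *ᵥ ·) h1
    beta_reduce at h2
    rwa [Matrix.mulVec_mulVec, ← Matrix.mul_assoc, Matrix.mul_nonsing_inv _ hu, Matrix.one_mul,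
      Matrix.mulVec_smul] at h2
  · rintro ⟨v, hv, h⟩
    refine Module.End.hasEigenvalue_of_hasEigenvector
      ⟨Module.End.mem_eigenspace_iff.mpr ?_, hv⟩
    rw [Matrix.toLin'_apply, ← Matrix.mulVec_mulVec, h, Matrix.mulVec_smul, Matrix.mulVec_mulVec,
      Matrix.nonsing_inv_mul _ hu, Matrix.one_mulVec]

lemma quadForm_circleMatrix (a r : ℝ) (u : Fin 3 → ℝ) :
    quadForm (circleMatrix a r) u =
      (u 0 - a * u 2) ^ 2 + u 1 ^ 2 - r ^ 2 * u 2 ^ 2 := by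
  simp [quadForm, circleMatrix, dotProduct, Matrix.mulVec, Fin.sum_univ_three]
  ring

lemma det_circleMatrix (a r : ℝ) : (circleMatrix a r).det = -r ^ 2 := by
  simp [circleMatrix, Matrix.det_fin_three]
  ring

lemma isEllipseMatrix_circleMatrix (a : ℝ) {r : ℝ} (hr : 0 < r) :
    IsEllipseMatrix (circleMatrix a r) where
  symm := by
    refine Matrix.IsSymm.ext fun i j => ?_
    fin_cases i <;> fin_cases j <;> simp [circleMatrix]
  pos := fun x y hxy => by
    rw [quadForm_circleMatrix]
    simp only [Matrix.cons_val_zero, Matrix.cons_val_one, Matrix.cons_val]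
    rcases eq_or_ne x 0 with rfl | hx
    · have hy : y ≠ 0 := fun h => hxy (by rw [h])
      have := pow_pos (abs_pos.mpr hy) 2
      rw [sq_abs] at this
      linarith
    · have := pow_pos (abs_pos.mpr hx) 2
      rw [sq_abs] at this
      nlinarith [sq_nonneg y]
  det_neg := by
    rw [det_circleMatrix]
    linarith [pow_pos hr 2]

lemma circleMatrix_inside {a r R : ℝ} (ha : 0 < a) (hr : 0 < r) (hR : r + a < R)
    {u : Fin 3 → ℝ} (hu : u ≠ 0) (h : quadForm (circleMatrix a r) u = 0) :
    quadForm (circleMatrix 0 R) u < 0 := by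
  rw [quadForm_circleMatrix] at h ⊢
  have hz : u 2 ≠ 0 := fun hz => hu <| by
    rw [hz] at h
    have h0 : u 0 = 0 := by nlinarith [sq_nonneg (u 0), sq_nonneg (u 1)]
    have h1 : u 1 = 0 := by nlinarith [sq_nonneg (u 0), sq_nonneg (u 1)]
    ext i
    fin_cases i
    · exact h0
    · exact h1
    · exact hz
  have hz2 : 0 < u 2 ^ 2 := by positivity
  generalize u 0 = x at *
  generalize u 1 = y at *
  generalize u 2 = z at *
  have h1 : (x - a * z) * z ≤ r * z ^ 2 := by
    have : r * ((x - a * z) * z) ≤ r * (r * z ^ 2) := by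
      nlinarith [sq_nonneg (x - a * z - r * z), sq_nonneg y]
    exact le_of_mul_le_mul_left this hr
  have h2 : x ^ 2 + y ^ 2 ≤ (r + a) ^ 2 * z ^ 2 := by nlinarith
  have h3 : (r + a) ^ 2 < R ^ 2 := by nlinarith
  nlinarith

lemma hasEigenvalue_circleMatrix_one {a r R : ℝ} (hR : R ≠ 0) :
    Module.End.HasEigenvalue (Matrix.toLin' ((circleMatrix 0 R)⁻¹ * circleMatrix a r)) 1 := by
  rw [hasEigenvalue_inv_mul_iff (by rw [det_circleMatrix]; simpa using hR)]
  refine ⟨![0, 1, 0], fun h => by simpa using congrFun h 1, ?_⟩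
  ext i
  fin_cases i <;> simp [circleMatrix, Matrix.mulVec, dotProduct, Fin.sum_univ_three]

lemma hasEigenvalue_circleMatrix {a r R μ : ℝ} (ha : a ≠ 0) (hR : R ≠ 0)
    (h : R ^ 2 * μ ^ 2 - (R ^ 2 + r ^ 2 - a ^ 2) * μ + r ^ 2 = 0) :
    Module.End.HasEigenvalue (Matrix.toLin' ((circleMatrix 0 R)⁻¹ * circleMatrix a r)) μ := by
  rw [hasEigenvalue_inv_mul_iff (by rw [det_circleMatrix]; simpa using hR)]
  refine ⟨![a, 0, 1 - μ], fun h => ha (by simpa using congrFun h 0), ?_⟩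
  ext i
  fin_cases i <;> simp [circleMatrix, Matrix.mulVec, dotProduct, Fin.sum_univ_three]
  · ring
  · linear_combination -h

/-- Here x and y are the eigenvalues below 1. Since x - y and xy are positive, the condition may be
squared, which makes it symmetric and expressible through sum and product. -/
lemma fuss_iff {a r R x y : ℝ} (ha : 0 < a) (hr : 0 < r) (hR : r + a < R) (hyx : y < x)
    (hy : 0 < y) (hsum : R ^ 2 * (x + y) = R ^ 2 + r ^ 2 - a ^ 2) (hprod : R ^ 2 * (x * y) = r ^ 2) :
    1 * x - 1 * y - x * y = 0 ↔ 1 / (R - a) ^ 2 + 1 / (R + a) ^ 2 = 1 / r ^ 2 := by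
  have h1 : R - a ≠ 0 := by linarith
  have h2 : R + a ≠ 0 := by linarith
  have hR0 : R ≠ 0 := by linarith
  have e1 : 1 / (R - a) ^ 2 + 1 / (R + a) ^ 2 = 1 / r ^ 2 ↔
      (R ^ 2 - a ^ 2) ^ 2 = 2 * r ^ 2 * (R ^ 2 + a ^ 2) := by
    field_simp
    constructor <;> intro h <;> linear_combination -h
  have e2 : 1 * x - 1 * y - x * y = 0 ↔ (x - y) ^ 2 = (x * y) ^ 2 := by
    rw [pow_left_inj₀ (by linarith) (mul_pos (hy.trans hyx) hy).le two_ne_zero]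
    constructor <;> intro h <;> linarith
  rw [e1, e2, ← mul_right_inj' (pow_ne_zero 4 hR0)]
  have e3 : R ^ 4 * (x - y) ^ 2 = (R ^ 2 + r ^ 2 - a ^ 2) ^ 2 - 4 * R ^ 2 * r ^ 2 := by
    rw [← hsum, ← hprod]; ring
  have e4 : R ^ 4 * (x * y) ^ 2 = r ^ 4 := by
    linear_combination (R ^ 2 * (x * y) + r ^ 2) * hprod
  rw [e3, e4]
  constructor <;> intro h <;> linear_combination h

/-- With p = √x and q = √y the condition is p - q = pq. Squaring leaves x + y and pq = r/R, the
latter being the positive root of the product formula. -/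
lemma euler_chapple_iff {a r R x y : ℝ} (ha : 0 < a) (hr : 0 < r) (hR : r + a < R) (hyx : y < x)
    (hy : 0 < y) (hsum : R ^ 2 * (x + y) = R ^ 2 + r ^ 2 - a ^ 2) (hprod : R ^ 2 * (x * y) = r ^ 2) :
    1 / √y = 1 / √1 + 1 / √x ↔ 1 / (R - a) + 1 / (R + a) = 1 / r := by
  have h1 : R - a ≠ 0 := by linarith
  have h2 : R + a ≠ 0 := by linarith
  have hR0 : 0 < R := by linarith
  have hx2 := Real.sq_sqrt (hy.trans hyx).le
  have hy2 := Real.sq_sqrt hy.le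
  have hx0 := Real.sqrt_pos.mpr (hy.trans hyx)
  have hy0 := Real.sqrt_pos.mpr hy
  have hlt := Real.sqrt_lt_sqrt hy.le hyx
  rw [Real.sqrt_one]
  generalize √x = p at *
  generalize √y = q at *
  have hpq : R * (p * q) = r := by
    refine (pow_left_inj₀ (by positivity) hr.le two_ne_zero).mp ?_
    rw [← hprod, ← hx2, ← hy2]; ring
  have e1 : 1 / (R - a) + 1 / (R + a) = 1 / r ↔ R ^ 2 - a ^ 2 = 2 * R * r := by
    field_simp
    constructor <;> intro h <;> linear_combination -h
  have e2 : 1 / q = 1 / 1 + 1 / p ↔ p - q = p * q := by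
    field_simp
    constructor <;> intro h <;> linear_combination h
  rw [e1, e2, ← pow_left_inj₀ (by linarith) (by positivity) two_ne_zero,
    ← mul_right_inj' (pow_ne_zero 2 hR0.ne')]
  have e3 : R ^ 2 * (p - q) ^ 2 = R ^ 2 - a ^ 2 + r ^ 2 - 2 * R * r := by
    rw [← hpq]
    rw [← hpq, ← hx2, ← hy2] at hsum
    linear_combination hsum
  have e4 : R ^ 2 * (p * q) ^ 2 = r ^ 2 := by rw [← hpq]; ring
  rw [e3, e4]
  constructor <;> intro h <;> linarith

lemma circle_pair {a r R : ℝ} (ha : 0 < a) (hr : 0 < r) (hR : r + a < R) :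
    ∃ lam₁ lam₂ lam₃ : ℝ,
      IsEllipsePair (circleMatrix 0 R) (circleMatrix a r) lam₁ lam₂ lam₃ ∧
      (lam₁ * lam₂ - lam₁ * lam₃ - lam₂ * lam₃ = 0 ↔
        1 / (R - a) ^ 2 + 1 / (R + a) ^ 2 = 1 / r ^ 2) ∧
      (1 / √lam₃ = 1 / √lam₁ + 1 / √lam₂ ↔ 1 / (R - a) + 1 / (R + a) = 1 / r) := by
  have hR0 : 0 < R := by linarith
  have hd : 0 < (R ^ 2 + r ^ 2 - a ^ 2) ^ 2 - 4 * R ^ 2 * r ^ 2 := by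
    -- The quadratic of the two smaller eigenvalues has real roots because its discriminant splits
    -- into four factors, positive when r + a < R.
    have : (R ^ 2 + r ^ 2 - a ^ 2) ^ 2 - 4 * R ^ 2 * r ^ 2 =
        (R - r - a) * (R - r + a) * ((R + r - a) * (R + r + a)) := by ring
    rw [this]
    exact mul_pos (mul_pos (by linarith) (by linarith)) (mul_pos (by linarith) (by linarith))
  set D := √((R ^ 2 + r ^ 2 - a ^ 2) ^ 2 - 4 * R ^ 2 * r ^ 2) with hD
  have hD0 : 0 < D := Real.sqrt_pos.mpr hd
  have hD2 : D ^ 2 = (R ^ 2 + r ^ 2 - a ^ 2) ^ 2 - 4 * R ^ 2 * r ^ 2 := Real.sq_sqrt hd.le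
  have hs0 : 0 < R ^ 2 + r ^ 2 - a ^ 2 := by nlinarith
  have hsum : R ^ 2 * ((R ^ 2 + r ^ 2 - a ^ 2 + D) / (2 * R ^ 2) +
      (R ^ 2 + r ^ 2 - a ^ 2 - D) / (2 * R ^ 2)) = R ^ 2 + r ^ 2 - a ^ 2 := by
    field_simp; ring
  have hprod : R ^ 2 * ((R ^ 2 + r ^ 2 - a ^ 2 + D) / (2 * R ^ 2) *
      ((R ^ 2 + r ^ 2 - a ^ 2 - D) / (2 * R ^ 2))) = r ^ 2 := by
    field_simp; linear_combination -hD2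
  have hyx : (R ^ 2 + r ^ 2 - a ^ 2 - D) / (2 * R ^ 2) <
      (R ^ 2 + r ^ 2 - a ^ 2 + D) / (2 * R ^ 2) :=
    div_lt_div_of_pos_right (by linarith) (by positivity)
  have hy : 0 < (R ^ 2 + r ^ 2 - a ^ 2 - D) / (2 * R ^ 2) := by
    refine div_pos (sub_pos.mpr (lt_of_pow_lt_pow_left₀ 2 hs0.le ?_)) (by positivity)
    rw [hD2]
    have : 0 < R ^ 2 * r ^ 2 := by positivity
    linarith
  have hx1 : (R ^ 2 + r ^ 2 - a ^ 2 + D) / (2 * R ^ 2) < 1 := by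
    rw [div_lt_one (by positivity)]
    have h1 : 0 < R ^ 2 - r ^ 2 + a ^ 2 := by nlinarith
    have : D < R ^ 2 - r ^ 2 + a ^ 2 := by
      refine lt_of_pow_lt_pow_left₀ 2 h1.le ?_
      rw [hD2]
      have : 0 < R ^ 2 * a ^ 2 := by positivity
      linarith
    linarith
  generalize (R ^ 2 + r ^ 2 - a ^ 2 + D) / (2 * R ^ 2) = x at *
  generalize (R ^ 2 + r ^ 2 - a ^ 2 - D) / (2 * R ^ 2) = y at *
  exact ⟨1, x, y,
    { outer := isEllipseMatrix_circleMatrix 0 hR0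
      inner := isEllipseMatrix_circleMatrix a hr
      inside := fun u hu h => circleMatrix_inside ha hr hR hu h
      eigen₁ := hasEigenvalue_circleMatrix_one hR0.ne'
      eigen₂ := hasEigenvalue_circleMatrix ha.ne' hR0.ne'
        (by rw [← hsum, ← hprod]; ring)
      eigen₃ := hasEigenvalue_circleMatrix ha.ne' hR0.ne'
        (by rw [← hsum, ← hprod]; ring)
      lt₁₂ := hx1
      lt₂₃ := hyx
      pos₃ := hy },
    fuss_iff ha hr hR hyx hy hsum hprod, euler_chapple_iff ha hr hR hyx hy hsum hprod⟩

/-! ### The frame of common conjugate directions -/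

/-- `M` carries the unit circle to the conic of `Co` and `x² / a² + y² / b² = 1` to the conic of
`Ci`, preserving orientation and without sending a point of the closed disc to infinity. -/
structure IsAdaptedFrame (Co Ci M : Matrix (Fin 3) (Fin 3) ℝ) (a b c : ℝ) : Prop where
  outer : ∀ y z, (M *ᵥ y) ⬝ᵥ (Co *ᵥ (M *ᵥ z)) = y 0 * z 0 + y 1 * z 1 - y 2 * z 2
  inner : ∀ y z, (M *ᵥ y) ⬝ᵥ (Ci *ᵥ (M *ᵥ z)) =
    c * (b ^ 2 * (y 0 * z 0) + a ^ 2 * (y 1 * z 1) - a ^ 2 * b ^ 2 * (y 2 * z 2))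
  scale_pos : 0 < c
  det_pos : 0 < M.det
  pos : ∀ y : Fin 3 → ℝ, y 0 ^ 2 + y 1 ^ 2 ≤ y 2 ^ 2 → 0 < y 2 → 0 < (M *ᵥ y) 2

lemma Matrix.IsSymm.dotProduct_mulVec_comm {n : Type*} [Fintype n] {C : Matrix n n ℝ}
    (h : C.IsSymm) (u v : n → ℝ) : u ⬝ᵥ (C *ᵥ v) = v ⬝ᵥ (C *ᵥ u) := by
  rw [Matrix.dotProduct_mulVec, ← Matrix.mulVec_transpose, h.eq, dotProduct_comm]

lemma IsEllipseMatrix.quadForm_pos {C : Matrix (Fin 3) (Fin 3) ℝ} (h : IsEllipseMatrix C)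
    {u : Fin 3 → ℝ} (hu : u ≠ 0) (h2 : u 2 = 0) : 0 < quadForm C u := by
  have h1 : u = ![u 0, u 1, 0] := by
    ext i; fin_cases i
    · rfl
    · rfl
    · exact h2
  rw [h1]
  refine h.pos _ _ fun h0 => hu ?_
  rw [Prod.mk.injEq] at h0
  rw [h1, h0.1, h0.2]
  ext i; fin_cases i <;> rfl

lemma exists_scale {d c : ℝ} (hd : 0 < d) (hc : c ≠ 0) : ∃ s : ℝ, d * s ^ 2 = 1 ∧ 0 < c * s := by
  have hs := Real.sqrt_pos.mpr hd
  have h2 := Real.sq_sqrt hd.le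
  rcases hc.lt_or_gt with h | h
  · refine ⟨-(√d)⁻¹, ?_, mul_pos_of_neg_of_neg h (neg_neg_of_pos (inv_pos.mpr hs))⟩
    rw [neg_sq, inv_pow, h2, mul_inv_cancel₀ hd.ne']
  · refine ⟨(√d)⁻¹, ?_, mul_pos h (inv_pos.mpr hs)⟩
    rw [inv_pow, h2, mul_inv_cancel₀ hd.ne']

/-- The outer form is positive on nonzero vectors at infinity and nonpositive on the cone over the
disc, so the height vanishes nowhere on the upper half of the cone. It is positive on the axis,
hence everywhere there. -/
lemma IsEllipseMatrix.frame_third_pos {Co M : Matrix (Fin 3) (Fin 3) ℝ} (h : IsEllipseMatrix Co)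
    (ho : ∀ y z, (M *ᵥ y) ⬝ᵥ (Co *ᵥ (M *ᵥ z)) = y 0 * z 0 + y 1 * z 1 - y 2 * z 2)
    (hdet : M.det ≠ 0) (h22 : 0 < M 2 2) {y : Fin 3 → ℝ} (hy : y 0 ^ 2 + y 1 ^ 2 ≤ y 2 ^ 2)
    (hy2 : 0 < y 2) : 0 < (M *ᵥ y) 2 := by
  have key : ∀ z : Fin 3 → ℝ, z 0 ^ 2 + z 1 ^ 2 ≤ z 2 ^ 2 → 0 < z 2 → (M *ᵥ z) 2 ≠ 0 := by
    intro z hz hz2 h0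
    have hne : M *ᵥ z ≠ 0 := fun hM => by
      rw [Matrix.eq_zero_of_mulVec_eq_zero hdet hM] at hz2
      exact lt_irrefl _ hz2
    have h1 := h.quadForm_pos hne h0
    rw [quadForm, ho] at h1
    linarith
  have hexp : ∀ z : Fin 3 → ℝ, (M *ᵥ z) 2 = M 2 0 * z 0 + M 2 1 * z 1 + M 2 2 * z 2 := fun z => by
    simp [Matrix.mulVec, dotProduct, Fin.sum_univ_three]
  by_contra hneg
  have h1 := hexp y
  have hp := mul_pos h22 hy2
  have hD : 0 < M 2 2 * y 2 - (M *ᵥ y) 2 := by linarith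
  -- The height is affine along the segment from (0, 0, y 2) to y; this is the parameter of its zero
  -- if y had nonpositive height.
  set s := M 2 2 * y 2 / (M 2 2 * y 2 - (M *ᵥ y) 2) with hs
  have hs0 : 0 ≤ s := (div_pos hp hD).le
  have hs1 : s ≤ 1 := (div_le_one hD).mpr (by linarith)
  refine key ![s * y 0, s * y 1, y 2] ?_ hy2 ?_
  · simp only [Matrix.cons_val_zero, Matrix.cons_val_one, Matrix.cons_val]
    have : s ^ 2 ≤ 1 := by nlinarith
    nlinarith [sq_nonneg (y 0), sq_nonneg (y 1)]
  · rw [hexp]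
    simp only [Matrix.cons_val_zero, Matrix.cons_val_one, Matrix.cons_val]
    have h3 : s * (M 2 2 * y 2 - (M *ᵥ y) 2) = M 2 2 * y 2 := div_mul_cancel₀ _ hD.ne'
    linear_combination -s * h1 - h3

lemma mulVec_of_columns (v : Fin 3 → Fin 3 → ℝ) (y : Fin 3 → ℝ) :
    (Matrix.of fun i j => v j i) *ᵥ y = y 0 • v 0 + y 1 • v 1 + y 2 • v 2 := by
  ext i
  simp [Matrix.mulVec, dotProduct, Fin.sum_univ_three]
  ring

/-- The frame of common conjugate directions of two ellipses. -/
lemma IsEllipsePair.exists_frame {Co Ci : Matrix (Fin 3) (Fin 3) ℝ} {l₁ l₂ l₃ : ℝ}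
    (h : IsEllipsePair Co Ci l₁ l₂ l₃) :
    ∃ M, IsAdaptedFrame Co Ci M √(l₃ / l₁) √(l₃ / l₂) (l₁ * l₂ / l₃) := by
  have hdet : Co.det ≠ 0 := h.outer.det_neg.ne
  have p3 := h.pos₃
  have p2 : 0 < l₂ := p3.trans h.lt₂₃
  have p1 : 0 < l₁ := p2.trans h.lt₁₂
  obtain ⟨v₁, n₁, e₁⟩ := (hasEigenvalue_inv_mul_iff hdet _).mp h.eigen₁
  obtain ⟨v₂, n₂, e₂⟩ := (hasEigenvalue_inv_mul_iff hdet _).mp h.eigen₂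
  obtain ⟨v₃, n₃, e₃⟩ := (hasEigenvalue_inv_mul_iff hdet _).mp h.eigen₃
  have orth : ∀ (u v : Fin 3 → ℝ) (k l : ℝ), l ≠ k → Ci *ᵥ u = k • (Co *ᵥ u) →
      Ci *ᵥ v = l • (Co *ᵥ v) → u ⬝ᵥ (Co *ᵥ v) = 0 := by
    intro u v k l hkl hu hv
    have h1 := h.inner.symm.dotProduct_mulVec_comm u v
    rw [hu, hv, dotProduct_smul, dotProduct_smul, h.outer.symm.dotProduct_mulVec_comm v u,
      smul_eq_mul, smul_eq_mul] at h1
    have h2 : (l - k) * (u ⬝ᵥ (Co *ᵥ v)) = 0 := by linarith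
    exact (mul_eq_zero.mp h2).resolve_left (sub_ne_zero.mpr hkl)
  have o₁₂ := orth v₁ v₂ l₁ l₂ h.lt₁₂.ne e₁ e₂
  have o₂₁ := orth v₂ v₁ l₂ l₁ h.lt₁₂.ne' e₂ e₁
  have o₁₃ := orth v₁ v₃ l₁ l₃ (h.lt₂₃.trans h.lt₁₂).ne e₁ e₃
  have o₃₁ := orth v₃ v₁ l₃ l₁ (h.lt₂₃.trans h.lt₁₂).ne' e₃ e₁
  have o₂₃ := orth v₂ v₃ l₂ l₃ h.lt₂₃.ne e₂ e₃
  have o₃₂ := orth v₃ v₂ l₃ l₂ h.lt₂₃.ne' e₃ e₂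
  set V : Matrix (Fin 3) (Fin 3) ℝ := Matrix.of fun i j => ![v₁, v₂, v₃] j i with hV
  have hmul : ∀ y, V *ᵥ y = y 0 • v₁ + y 1 • v₂ + y 2 • v₃ := fun y =>
    mulVec_of_columns ![v₁, v₂, v₃] y
  set d₁ := v₁ ⬝ᵥ (Co *ᵥ v₁) with hd₁
  set d₂ := v₂ ⬝ᵥ (Co *ᵥ v₂) with hd₂
  set d₃ := v₃ ⬝ᵥ (Co *ᵥ v₃) with hd₃
  have hCo : ∀ y z, (V *ᵥ y) ⬝ᵥ (Co *ᵥ (V *ᵥ z)) =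
      d₁ * (y 0 * z 0) + d₂ * (y 1 * z 1) + d₃ * (y 2 * z 2) := by
    intro y z
    rw [hmul, hmul]
    simp only [Matrix.mulVec_add, Matrix.mulVec_smul, add_dotProduct, dotProduct_add,
      smul_dotProduct, dotProduct_smul, smul_eq_mul, o₁₂, o₂₁, o₁₃, o₃₁, o₂₃, o₃₂, ← hd₁, ← hd₂,
      ← hd₃]
    ring
  have hCi : ∀ y z, (V *ᵥ y) ⬝ᵥ (Ci *ᵥ (V *ᵥ z)) =
      l₁ * d₁ * (y 0 * z 0) + l₂ * d₂ * (y 1 * z 1) + l₃ * d₃ * (y 2 * z 2) := by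
    intro y z
    rw [hmul, hmul]
    simp only [Matrix.mulVec_add, Matrix.mulVec_smul, add_dotProduct, dotProduct_add,
      smul_dotProduct, dotProduct_smul, smul_eq_mul, o₁₂, o₂₁, o₁₃, o₃₁, o₂₃, o₃₂, ← hd₁, ← hd₂,
      ← hd₃, e₁, e₂, e₃]
    ring
  have hVdet : V.det ≠ 0 := by
    have hli : LinearIndependent ℝ ![v₁, v₂, v₃] := by
      refine Module.End.eigenvectors_linearIndependent' (Matrix.toLin' (Co⁻¹ * Ci)) ![l₁, l₂, l₃]
        ?_ _ ?_
      · intro i j hij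
        have h12 := h.lt₁₂
        have h23 := h.lt₂₃
        fin_cases i <;> fin_cases j <;> simp at hij ⊢ <;> linarith
      · have mk : ∀ (v : Fin 3 → ℝ) (l : ℝ), v ≠ 0 → Ci *ᵥ v = l • (Co *ᵥ v) →
            Module.End.HasEigenvector (Matrix.toLin' (Co⁻¹ * Ci)) l v := by
          intro v l hv he
          refine ⟨Module.End.mem_eigenspace_iff.mpr ?_, hv⟩
          rw [Matrix.toLin'_apply, ← Matrix.mulVec_mulVec, he, Matrix.mulVec_smul,
            Matrix.mulVec_mulVec, Matrix.nonsing_inv_mul _ (isUnit_iff_ne_zero.mpr hdet),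
            Matrix.one_mulVec]
        intro i
        fin_cases i
        · exact mk _ _ n₁ e₁
        · exact mk _ _ n₂ e₂
        · exact mk _ _ n₃ e₃
    have := (Matrix.linearIndependent_cols_iff_isUnit (A := V)).mp hli
    exact ((Matrix.isUnit_iff_isUnit_det V).mp this).ne_zero
  -- Congruence preserves the sign of the determinant, so one or three of the diagonal entries are
  -- negative.
  have hprod : d₁ * d₂ * d₃ < 0 := by
    have h1 : Vᵀ * Co * V = Matrix.diagonal ![d₁, d₂, d₃] := by
      have hent : ∀ i j, (Vᵀ * Co * V) i j =
          (V *ᵥ Pi.single i 1) ⬝ᵥ (Co *ᵥ (V *ᵥ Pi.single j 1)) := by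
        intro i j
        rw [Matrix.mulVec_single_one, Matrix.mulVec_single_one, Matrix.mul_assoc]
        rfl
      ext i j
      rw [hent, hCo]
      fin_cases i <;> fin_cases j <;> simp [Matrix.diagonal]
    have h2 := congrArg Matrix.det h1
    rw [Matrix.det_mul, Matrix.det_mul, Matrix.det_transpose, Matrix.det_diagonal,
      Fin.prod_univ_three] at h2
    simp only [Matrix.cons_val_zero, Matrix.cons_val_one, Matrix.cons_val] at h2
    rw [← h2]
    have : 0 < V.det ^ 2 := by positivity
    nlinarith [h.outer.det_neg]
  have hinj : ∀ y, y ≠ 0 → V *ᵥ y ≠ 0 := fun y hy h0 =>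
    hy (Matrix.eq_zero_of_mulVec_eq_zero hVdet h0)
  have hnotneg : ¬ (d₁ < 0 ∧ d₂ < 0 ∧ d₃ < 0) := by
    rintro ⟨h1, h2, h3⟩
    have hw : V *ᵥ (V⁻¹ *ᵥ ![1, 0, 0]) = ![1, 0, 0] := by
      rw [Matrix.mulVec_mulVec, Matrix.mul_nonsing_inv _ (isUnit_iff_ne_zero.mpr hVdet),
        Matrix.one_mulVec]
    have h4 := h.outer.pos 1 0 (by simp)
    have h5 := hCo (V⁻¹ *ᵥ ![1, 0, 0]) (V⁻¹ *ᵥ ![1, 0, 0])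
    rw [hw] at h5
    rw [quadForm, h5] at h4
    nlinarith [mul_self_nonneg ((V⁻¹ *ᵥ ![1, 0, 0]) 0), mul_self_nonneg ((V⁻¹ *ᵥ ![1, 0, 0]) 1),
      mul_self_nonneg ((V⁻¹ *ᵥ ![1, 0, 0]) 2)]
  have hins : ∀ y : Fin 3 → ℝ, y ≠ 0 →
      l₁ * d₁ * (y 0 * y 0) + l₂ * d₂ * (y 1 * y 1) + l₃ * d₃ * (y 2 * y 2) = 0 →
      d₁ * (y 0 * y 0) + d₂ * (y 1 * y 1) + d₃ * (y 2 * y 2) < 0 := by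
    intro y hy h0
    rw [← hCi] at h0
    rw [← hCo]
    exact h.inside _ (hinj y hy) h0
  -- The test vector lies on the inner cone, yet the outer form takes there the value d₁ d₂ (λ₂ -
  -- λ₁) > 0, contradicting that the inner ellipse is inside. The next two cases are alike, and
  -- together they force the negative direction to belong to λ₃.
  have c₁₂ : ¬ (d₁ < 0 ∧ 0 < d₂) := by
    rintro ⟨h1, h2⟩
    have q1 : 0 < l₂ * d₂ := mul_pos p2 h2
    have q2 : 0 < l₁ * -d₁ := mul_pos p1 (by linarith)
    have s1 := Real.mul_self_sqrt q1.le
    have s2 := Real.mul_self_sqrt q2.le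
    have := hins ![√(l₂ * d₂), √(l₁ * -d₁), 0]
      (fun h0 => (Real.sqrt_pos.mpr q1).ne' (by simpa using congrFun h0 0))
    simp only [Matrix.cons_val_zero, Matrix.cons_val_one, Matrix.cons_val, s1, s2] at this
    have := this (by ring)
    nlinarith [mul_pos (mul_pos (neg_pos.mpr h1) h2) (sub_pos.mpr h.lt₁₂)]
  have c₁₃ : ¬ (d₁ < 0 ∧ 0 < d₃) := by
    rintro ⟨h1, h2⟩
    have q1 : 0 < l₃ * d₃ := mul_pos p3 h2
    have q2 : 0 < l₁ * -d₁ := mul_pos p1 (by linarith)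
    have s1 := Real.mul_self_sqrt q1.le
    have s2 := Real.mul_self_sqrt q2.le
    have := hins ![√(l₃ * d₃), 0, √(l₁ * -d₁)]
      (fun h0 => (Real.sqrt_pos.mpr q1).ne' (by simpa using congrFun h0 0))
    simp only [Matrix.cons_val_zero, Matrix.cons_val_one, Matrix.cons_val, s1, s2] at this
    have := this (by ring)
    nlinarith [mul_pos (mul_pos (neg_pos.mpr h1) h2) (sub_pos.mpr (h.lt₂₃.trans h.lt₁₂))]
  have c₂₃ : ¬ (d₂ < 0 ∧ 0 < d₃) := by
    rintro ⟨h1, h2⟩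
    have q1 : 0 < l₃ * d₃ := mul_pos p3 h2
    have q2 : 0 < l₂ * -d₂ := mul_pos p2 (by linarith)
    have s1 := Real.mul_self_sqrt q1.le
    have s2 := Real.mul_self_sqrt q2.le
    have := hins ![0, √(l₃ * d₃), √(l₂ * -d₂)]
      (fun h0 => (Real.sqrt_pos.mpr q1).ne' (by simpa using congrFun h0 1))
    simp only [Matrix.cons_val_zero, Matrix.cons_val_one, Matrix.cons_val, s1, s2] at this
    have := this (by ring)
    nlinarith [mul_pos (mul_pos (neg_pos.mpr h1) h2) (sub_pos.mpr h.lt₂₃)]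
  have z₁ : d₁ ≠ 0 := fun h0 => by rw [h0] at hprod; simp at hprod
  have z₂ : d₂ ≠ 0 := fun h0 => by rw [h0] at hprod; simp at hprod
  have z₃ : d₃ ≠ 0 := fun h0 => by rw [h0] at hprod; simp at hprod
  have hd1 : 0 < d₁ := by
    by_contra hn
    have hn : d₁ < 0 := lt_of_le_of_ne (not_lt.mp hn) z₁
    exact hnotneg ⟨hn, lt_of_le_of_ne (not_lt.mp fun hp => c₁₂ ⟨hn, hp⟩) z₂,
      lt_of_le_of_ne (not_lt.mp fun hp => c₁₃ ⟨hn, hp⟩) z₃⟩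
  have hd2 : 0 < d₂ := by
    by_contra hn
    have hn : d₂ < 0 := lt_of_le_of_ne (not_lt.mp hn) z₂
    have h3 := lt_of_le_of_ne (not_lt.mp fun hp => c₂₃ ⟨hn, hp⟩) z₃
    have := mul_pos (mul_pos hd1 (neg_pos.mpr hn)) (neg_pos.mpr h3)
    linarith
  have hd3 : 0 < -d₃ := by
    by_contra hn
    have := mul_nonneg (mul_pos hd1 hd2).le (show 0 ≤ d₃ by linarith)
    linarith
  have hV22 : V 2 2 ≠ 0 := fun h0 => by
    have h1 := h.outer.quadForm_pos n₃ h0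
    rw [quadForm, ← hd₃] at h1
    linarith
  obtain ⟨s₃, hs3, hp3⟩ := exists_scale hd3 hV22
  have hs30 : s₃ ≠ 0 := fun h0 => by rw [h0] at hs3; simp at hs3
  obtain ⟨s₂, hs2, hp2⟩ := exists_scale hd2 one_ne_zero
  -- The sign of s₃ has made the height of the third column positive; the sign of s₁ is spent on
  -- making the determinant positive.
  obtain ⟨s₁, hs1, hp1⟩ := exists_scale hd1
    (mul_ne_zero (mul_ne_zero hVdet hs30) (by linarith : s₂ ≠ 0))
  set M := V * Matrix.diagonal ![s₁, s₂, s₃] with hM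
  have hMy : ∀ y, M *ᵥ y = V *ᵥ ![s₁ * y 0, s₂ * y 1, s₃ * y 2] := by
    intro y
    rw [hM, ← Matrix.mulVec_mulVec]
    congr 1
    ext i
    rw [Matrix.mulVec_diagonal]
    fin_cases i <;> rfl
  have hMdet : 0 < M.det := by
    rw [hM, Matrix.det_mul, Matrix.det_diagonal, Fin.prod_univ_three]
    simp only [Matrix.cons_val_zero, Matrix.cons_val_one, Matrix.cons_val]
    linarith
  have hM22 : 0 < M 2 2 := by
    rw [hM, Matrix.mul_diagonal]
    exact hp3
  have hout : ∀ y z, (M *ᵥ y) ⬝ᵥ (Co *ᵥ (M *ᵥ z)) = y 0 * z 0 + y 1 * z 1 - y 2 * z 2 := by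
    intro y z
    rw [hMy, hMy, hCo]
    simp only [Matrix.cons_val_zero, Matrix.cons_val_one, Matrix.cons_val]
    linear_combination (y 0 * z 0) * hs1 + (y 1 * z 1) * hs2 - (y 2 * z 2) * hs3
  refine ⟨M, hout, ?_, div_pos (mul_pos p1 p2) p3, hMdet,
    fun y hy hy2 => h.outer.frame_third_pos hout hMdet.ne' hM22 hy hy2⟩
  intro y z
  -- With c = λ₁λ₂/λ₃ one has c b² = λ₁, c a² = λ₂ and c a² b² = λ₃.
  rw [hMy, hMy, hCi, Real.sq_sqrt (div_pos p3 p1).le, Real.sq_sqrt (div_pos p3 p2).le]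
  simp only [Matrix.cons_val_zero, Matrix.cons_val_one, Matrix.cons_val]
  field_simp
  linear_combination l₁ * (y 0 * z 0) * hs1 + l₂ * (y 1 * z 1) * hs2 - l₃ * (y 2 * z 2) * hs3

/-! ### Homogeneous coordinates and orientation -/

/-- Homogeneous coordinates of the point of the unit circle at angle `t`. -/
noncomputable def circlePoint (t : ℝ) : Fin 3 → ℝ := ![Real.cos t, Real.sin t, 1]

@[simp] lemma circlePoint_zero (t : ℝ) : circlePoint t 0 = Real.cos t := rfl
@[simp] lemma circlePoint_one (t : ℝ) : circlePoint t 1 = Real.sin t := rfl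
@[simp] lemma circlePoint_two (t : ℝ) : circlePoint t 2 = 1 := rfl

/-- The determinant of three vectors. -/
def tripleProduct (u v w : Fin 3 → ℝ) : ℝ :=
  u 0 * (v 1 * w 2 - v 2 * w 1) - u 1 * (v 0 * w 2 - v 2 * w 0) + u 2 * (v 0 * w 1 - v 1 * w 0)

lemma tripleProduct_mulVec (M : Matrix (Fin 3) (Fin 3) ℝ) (u v w : Fin 3 → ℝ) :
    tripleProduct (M *ᵥ u) (M *ᵥ v) (M *ᵥ w) = M.det * tripleProduct u v w := by
  simp only [tripleProduct, Matrix.mulVec, dotProduct, Fin.sum_univ_three, Matrix.det_fin_three]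
  ring

lemma tripleProduct_smul (k l m : ℝ) (u v w : Fin 3 → ℝ) :
    tripleProduct (k • u) (l • v) (m • w) = k * l * m * tripleProduct u v w := by
  simp only [tripleProduct, Pi.smul_apply, smul_eq_mul]
  ring

/-- As a determinant, the side of a line survives linear maps of positive determinant and positive
rescalings of homogeneous coordinates. -/
lemma isOnLeft_iff (z₀ z₁ w : ℝ × ℝ) :
    IsOnLeft z₀ z₁ w ↔ 0 ≤ tripleProduct ![z₀.1, z₀.2, 1] ![z₁.1, z₁.2, 1] ![w.1, w.2, 1] := by
  rw [IsOnLeft]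
  refine Eq.to_iff (congrArg (0 ≤ ·) ?_)
  simp only [tripleProduct, Matrix.cons_val_zero, Matrix.cons_val_one, Matrix.cons_val]
  ring

/-- The affine point with the homogeneous coordinates `u`. -/
noncomputable def affinePoint (u : Fin 3 → ℝ) : ℝ × ℝ := (u 0 / u 2, u 1 / u 2)

lemma hom_affinePoint {u : Fin 3 → ℝ} (h : u 2 ≠ 0) :
    ![(affinePoint u).1, (affinePoint u).2, 1] = (u 2)⁻¹ • u := by
  ext i
  fin_cases i
  · exact div_eq_inv_mul _ _
  · exact div_eq_inv_mul _ _
  · exact (inv_mul_cancel₀ h).symm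

lemma quadForm_smul (C : Matrix (Fin 3) (Fin 3) ℝ) (k : ℝ) (u : Fin 3 → ℝ) :
    quadForm C (k • u) = k ^ 2 * quadForm C u := by
  rw [quadForm, Matrix.mulVec_smul, smul_dotProduct, dotProduct_smul, smul_eq_mul, smul_eq_mul,
    quadForm]
  ring

lemma affinePoint_mem_conic {C : Matrix (Fin 3) (Fin 3) ℝ} {u : Fin 3 → ℝ} (h : u 2 ≠ 0) :
    affinePoint u ∈ conic C ↔ quadForm C u = 0 := by
  change quadForm C ![(affinePoint u).1, (affinePoint u).2, 1] = 0 ↔ _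
  rw [hom_affinePoint h, quadForm_smul]
  simp [h]

lemma affinePoint_of_hom (w : ℝ × ℝ) {u : Fin 3 → ℝ} {k : ℝ} (hk : k ≠ 0)
    (h : u = k • ![w.1, w.2, 1]) : affinePoint u = w := by
  rw [h]
  ext <;> simp [affinePoint, hk]

/-! ### Poncelet steps in the frame -/

namespace IsAdaptedFrame

variable {Co Ci M : Matrix (Fin 3) (Fin 3) ℝ} {a b c : ℝ}

/-- The points of the cone over the disc which are mapped to positive height are in its upper
half. -/
lemma third_pos (h : IsAdaptedFrame Co Ci M a b c) {y : Fin 3 → ℝ}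
    (hy : y 0 ^ 2 + y 1 ^ 2 ≤ y 2 ^ 2) (hM : 0 < (M *ᵥ y) 2) : 0 < y 2 := by
  rcases lt_trichotomy (y 2) 0 with h0 | h0 | h0
  · have h1 := h.pos (-y) (by simpa using hy) (by simpa using h0)
    rw [Matrix.mulVec_neg, Pi.neg_apply] at h1
    linarith
  · have : y = 0 := by
      rw [h0] at hy
      have h1 : y 0 = 0 := by nlinarith [sq_nonneg (y 0), sq_nonneg (y 1)]
      have h2 : y 1 = 0 := by nlinarith [sq_nonneg (y 0), sq_nonneg (y 1)]
      ext i; fin_cases i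
      · exact h1
      · exact h2
      · exact h0
    rw [this, Matrix.mulVec_zero] at hM
    exact absurd hM (lt_irrefl _)
  · exact h0

lemma weight_pos (h : IsAdaptedFrame Co Ci M a b c) (t : ℝ) : 0 < (M *ᵥ circlePoint t) 2 := by
  refine h.pos _ ?_ ?_
  · simp
  · simp

lemma mulVec_inv (h : IsAdaptedFrame Co Ci M a b c) (u : Fin 3 → ℝ) : M *ᵥ (M⁻¹ *ᵥ u) = u := by
  rw [Matrix.mulVec_mulVec, Matrix.mul_nonsing_inv _ (isUnit_iff_ne_zero.mpr h.det_pos.ne'),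
    Matrix.one_mulVec]

lemma mulVec_injective (h : IsAdaptedFrame Co Ci M a b c) {u v : Fin 3 → ℝ}
    (huv : M *ᵥ u = M *ᵥ v) : u = v := by
  have := Matrix.eq_zero_of_mulVec_eq_zero h.det_pos.ne' (v := u - v)
    (by rw [Matrix.mulVec_sub, huv, sub_self])
  exact sub_eq_zero.mp this

lemma quadForm_outer (h : IsAdaptedFrame Co Ci M a b c) (y : Fin 3 → ℝ) :
    quadForm Co (M *ᵥ y) = y 0 ^ 2 + y 1 ^ 2 - y 2 ^ 2 := by
  rw [quadForm, h.outer]; ring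

lemma quadForm_inner (h : IsAdaptedFrame Co Ci M a b c) (y : Fin 3 → ℝ) :
    quadForm Ci (M *ᵥ y) = c * (b ^ 2 * y 0 ^ 2 + a ^ 2 * y 1 ^ 2 - a ^ 2 * b ^ 2 * y 2 ^ 2) := by
  rw [quadForm, h.inner]; ring

/-- The parametrization of the outer conic by the unit circle. -/
noncomputable def _root_.framePoint (M : Matrix (Fin 3) (Fin 3) ℝ) (t : ℝ) : ℝ × ℝ :=
  affinePoint (M *ᵥ circlePoint t)

lemma framePoint_mem (h : IsAdaptedFrame Co Ci M a b c) (t : ℝ) : framePoint M t ∈ conic Co := by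
  rw [framePoint, affinePoint_mem_conic (h.weight_pos t).ne', h.quadForm_outer]
  simp

lemma exists_framePoint (h : IsAdaptedFrame Co Ci M a b c) {z : ℝ × ℝ} (hz : z ∈ conic Co) :
    ∃ t, framePoint M t = z := by
  have hMy := h.mulVec_inv ![z.1, z.2, 1]
  have hz' : quadForm Co ![z.1, z.2, 1] = 0 := hz
  set y := M⁻¹ *ᵥ ![z.1, z.2, 1]
  rw [← hMy, h.quadForm_outer] at hz'
  have hy2 : 0 < y 2 := h.third_pos (by linarith) (by rw [hMy]; exact one_pos)
  set ζ : ℂ := ⟨y 0 / y 2, y 1 / y 2⟩ with hζ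
  have hn : ‖ζ‖ = 1 := by
    rw [Complex.norm_eq_sqrt_sq_add_sq, Real.sqrt_eq_one]
    change (y 0 / y 2) ^ 2 + (y 1 / y 2) ^ 2 = 1
    field_simp
    linarith
  refine ⟨ζ.arg, affinePoint_of_hom z (inv_ne_zero hy2.ne') ?_⟩
  have hcp : circlePoint ζ.arg = (y 2)⁻¹ • y := by
    have e1 := Complex.norm_mul_cos_arg ζ
    have e2 := Complex.norm_mul_sin_arg ζ
    rw [hn, one_mul] at e1 e2
    ext i
    fin_cases i
    · exact e1.trans (div_eq_inv_mul _ _)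
    · exact e2.trans (div_eq_inv_mul _ _)
    · exact (inv_mul_cancel₀ hy2.ne').symm
  rw [hcp, Matrix.mulVec_smul, hMy]

lemma framePoint_injective (h : IsAdaptedFrame Co Ci M a b c) {s t : ℝ}
    (hst : framePoint M s = framePoint M t) : ∃ n : ℤ, s = t + n * (2 * Real.pi) := by
  have hs := (h.weight_pos s).ne'
  have ht := (h.weight_pos t).ne'
  have h1 := hom_affinePoint hs
  have h2 := hom_affinePoint ht
  change ![(framePoint M s).1, (framePoint M s).2, 1] = _ at h1
  change ![(framePoint M t).1, (framePoint M t).2, 1] = _ at h2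
  rw [hst, h2, ← Matrix.mulVec_smul, ← Matrix.mulVec_smul] at h1
  have h3 := h.mulVec_injective h1
  have e2 := congrFun h3 2
  have e0 := congrFun h3 0
  have e1 := congrFun h3 1
  simp only [Pi.smul_apply, smul_eq_mul, circlePoint_two, circlePoint_zero, circlePoint_one,
    mul_one] at e0 e1 e2
  rw [e2] at e0 e1
  exact Real.exists_int_of_cos_eq_of_sin_eq (mul_left_cancel₀ (inv_ne_zero hs) e0.symm)
    (mul_left_cancel₀ (inv_ne_zero hs) e1.symm)

lemma framePoint_add (M : Matrix (Fin 3) (Fin 3) ℝ) (t : ℝ) (n : ℤ) :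
    framePoint M (t + n * (2 * Real.pi)) = framePoint M t := by
  rw [framePoint, framePoint, circlePoint, circlePoint, Real.cos_add_int_mul_two_pi,
    Real.sin_add_int_mul_two_pi]

lemma tripleProduct_chord (s d : ℝ) (y : Fin 3 → ℝ) :
    tripleProduct (circlePoint (s - d)) (circlePoint (s + d)) y =
      2 * Real.sin d * (y 2 * Real.cos d - y 0 * Real.cos s - y 1 * Real.sin s) := by
  simp only [tripleProduct, circlePoint_zero, circlePoint_one, circlePoint_two, Real.cos_sub,
    Real.cos_add, Real.sin_sub, Real.sin_add]
  have hs := Real.sin_sq_add_cos_sq s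
  linear_combination (2 * Real.sin d * Real.cos d * y 2) * hs

lemma isOnLeft_framePoint_iff (h : IsAdaptedFrame Co Ci M a b c) {s d : ℝ} (hd : 0 < Real.sin d)
    {y : Fin 3 → ℝ} (hy : 0 < (M *ᵥ y) 2) :
    IsOnLeft (framePoint M (s - d)) (framePoint M (s + d)) (affinePoint (M *ᵥ y)) ↔
      y 0 * Real.cos s + y 1 * Real.sin s ≤ y 2 * Real.cos d := by
  rw [isOnLeft_iff]
  unfold framePoint
  rw [hom_affinePoint (h.weight_pos _).ne', hom_affinePoint (h.weight_pos _).ne',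
    hom_affinePoint hy.ne', tripleProduct_smul, tripleProduct_mulVec, tripleProduct_chord]
  have hk := mul_pos (mul_pos (inv_pos.mpr (h.weight_pos (s - d)))
    (inv_pos.mpr (h.weight_pos (s + d)))) (inv_pos.mpr hy)
  rw [mul_nonneg_iff_of_pos_left hk, mul_nonneg_iff_of_pos_left h.det_pos,
    mul_nonneg_iff_of_pos_left (by linarith)]
  constructor <;> intro h' <;> linarith

/-- A chord with the inner conic on its left spans less than a half turn. -/
lemma cos_pos_of_left (h : IsAdaptedFrame Co Ci M a b c) (hab : IsAxes a b) {s d : ℝ}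
    (hd : 0 < Real.sin d)
    (hl : ∀ w ∈ conic Ci, IsOnLeft (framePoint M (s - d)) (framePoint M (s + d)) w) :
    0 < Real.cos d := by
  have hN : 0 < a ^ 2 * Real.cos s ^ 2 + b ^ 2 * Real.sin s ^ 2 := by
    linarith [IsAxes.combo_pos (pow_pos hab.pos' 2) (pow_pos hab.pos 2) s]
  have hN0 := Real.sqrt_pos.mpr hN
  have hN2 := Real.sq_sqrt hN.le
  set N := √(a ^ 2 * Real.cos s ^ 2 + b ^ 2 * Real.sin s ^ 2)
  -- This is the point of the inner ellipse furthest in the direction s, at distance N; being left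
  -- of the chord means N ≤ cos d.
  set y : Fin 3 → ℝ := ![a ^ 2 * Real.cos s, b ^ 2 * Real.sin s, N] with hy
  have y0 : y 0 = a ^ 2 * Real.cos s := rfl
  have y1 : y 1 = b ^ 2 * Real.sin s := rfl
  have y2 : y 2 = N := rfl
  have hy2 : 0 < (M *ᵥ y) 2 := by
    refine h.pos y ?_ hN0
    rw [y0, y1, y2, hN2]
    have e1 := mul_nonneg (mul_nonneg (sq_nonneg a) (sub_pos.mpr hab.sq_lt_one).le)
      (sq_nonneg (Real.cos s))
    have e2 := mul_nonneg (mul_nonneg (sq_nonneg b) (sub_pos.mpr hab.sq_lt_one').le)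
      (sq_nonneg (Real.sin s))
    linarith
  have hmem : affinePoint (M *ᵥ y) ∈ conic Ci := by
    rw [affinePoint_mem_conic hy2.ne', h.quadForm_inner, y0, y1, y2, hN2]
    ring
  have := (h.isOnLeft_framePoint_iff hd hy2).mp (hl _ hmem)
  rw [y0, y1, y2] at this
  have h3 : N * N ≤ N * Real.cos d := by linarith
  exact hN0.trans_le (le_of_mul_le_mul_left h3 hN0)

/-- A line touches the inner conic when its form, restricted to the span of two points of the line,
is degenerate. For the end points of the chord the Gram determinant is the defect in the tangency
equation times a factor that is nonzero when a, b and sin d are. -/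
lemma gram_chord (s d : ℝ) :
    (b ^ 2 * Real.cos (s - d) ^ 2 + a ^ 2 * Real.sin (s - d) ^ 2 - a ^ 2 * b ^ 2) *
      (b ^ 2 * Real.cos (s + d) ^ 2 + a ^ 2 * Real.sin (s + d) ^ 2 - a ^ 2 * b ^ 2) -
      (b ^ 2 * (Real.cos (s - d) * Real.cos (s + d)) +
        a ^ 2 * (Real.sin (s - d) * Real.sin (s + d)) - a ^ 2 * b ^ 2) ^ 2 =
    4 * (a ^ 2 * b ^ 2 * Real.sin d ^ 2) *
      (Real.cos d ^ 2 - (a ^ 2 * Real.cos s ^ 2 + b ^ 2 * Real.sin s ^ 2)) := by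
  have e1 : Real.cos (s - d) * Real.sin (s + d) - Real.sin (s - d) * Real.cos (s + d) =
      2 * Real.sin d * Real.cos d := by
    rw [← Real.sin_two_mul, show 2 * d = (s + d) - (s - d) by ring, Real.sin_sub (s + d)]; ring
  have e2 : Real.cos (s - d) - Real.cos (s + d) = 2 * Real.sin s * Real.sin d := by
    rw [Real.cos_sub, Real.cos_add]; ring
  have e3 : Real.sin (s + d) - Real.sin (s - d) = 2 * Real.cos s * Real.sin d := by
    rw [Real.sin_sub, Real.sin_add]; ring
  calc _ = b ^ 2 * a ^ 2 * (Real.cos (s - d) * Real.sin (s + d) -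
        Real.sin (s - d) * Real.cos (s + d)) ^ 2 -
        b ^ 2 * (a ^ 2 * b ^ 2) * (Real.cos (s - d) - Real.cos (s + d)) ^ 2 -
        a ^ 2 * (a ^ 2 * b ^ 2) * (Real.sin (s + d) - Real.sin (s - d)) ^ 2 := by ring
    _ = _ := by rw [e1, e2, e3]; ring

/-- The chord of a segment which touches the inner conic satisfies the tangency equation. -/
lemma tangency_of_tangent (h : IsAdaptedFrame Co Ci M a b c) (hab : IsAxes a b) {s d : ℝ}
    (hd : 0 < Real.sin d)
    (ht : ∃ w ∈ segment ℝ (framePoint M (s - d)) (framePoint M (s + d)),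
      IsTangentAt Ci w (framePoint M (s + d) - framePoint M (s - d))) :
    a ^ 2 * Real.cos s ^ 2 + b ^ 2 * Real.sin s ^ 2 = Real.cos d ^ 2 := by
  obtain ⟨w, ⟨p, q, hp, hq, hpq, rfl⟩, hmem, htan⟩ := ht
  have hwa := h.weight_pos (s - d)
  have hwb := h.weight_pos (s + d)
  have ea := hom_affinePoint hwa.ne'
  have eb := hom_affinePoint hwb.ne'
  change ![(framePoint M (s - d)).1, (framePoint M (s - d)).2, 1] = _ at ea
  change ![(framePoint M (s + d)).1, (framePoint M (s + d)).2, 1] = _ at eb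
  set z₀ := framePoint M (s - d)
  set z₁ := framePoint M (s + d)
  set Wa := (M *ᵥ circlePoint (s - d)) 2
  set Wb := (M *ᵥ circlePoint (s + d)) 2
  have ew : ![(p • z₀ + q • z₁).1, (p • z₀ + q • z₁).2, 1] =
      M *ᵥ ((p * Wa⁻¹) • circlePoint (s - d) + (q * Wb⁻¹) • circlePoint (s + d)) := by
    rw [Matrix.mulVec_add, Matrix.mulVec_smul, Matrix.mulVec_smul, mul_smul, mul_smul, ← ea, ← eb]
    ext i
    fin_cases i <;> simp [hpq]
  have ev : ![(z₁ - z₀).1, (z₁ - z₀).2, 0] =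
      M *ᵥ (Wb⁻¹ • circlePoint (s + d) - Wa⁻¹ • circlePoint (s - d)) := by
    rw [Matrix.mulVec_sub, Matrix.mulVec_smul, Matrix.mulVec_smul, ← ea, ← eb]
    ext i
    fin_cases i <;> simp
  rw [ev, ew, h.inner] at htan
  change quadForm Ci _ = 0 at hmem
  rw [ew, quadForm, h.inner] at hmem
  have hgram := gram_chord (a := a) (b := b) s d
  simp only [Pi.add_apply, Pi.sub_apply, Pi.smul_apply, smul_eq_mul, circlePoint_zero,
    circlePoint_one, circlePoint_two, mul_one] at htan hmem
  generalize Real.cos (s - d) = xa at *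
  generalize Real.cos (s + d) = xb at *
  generalize Real.sin (s - d) = ya at *
  generalize Real.sin (s + d) = yb at *
  have htan := (mul_eq_zero.mp htan).resolve_left h.scale_pos.ne'
  have hmem := (mul_eq_zero.mp hmem).resolve_left h.scale_pos.ne'
  set Da := b ^ 2 * xa ^ 2 + a ^ 2 * ya ^ 2 - a ^ 2 * b ^ 2 with hDa
  set Db := b ^ 2 * xb ^ 2 + a ^ 2 * yb ^ 2 - a ^ 2 * b ^ 2 with hDb
  set E := b ^ 2 * (xa * xb) + a ^ 2 * (ya * yb) - a ^ 2 * b ^ 2 with hE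
  have hP : 0 < Wa⁻¹ := inv_pos.mpr hwa
  have hQ : 0 < Wb⁻¹ := inv_pos.mpr hwb
  generalize Wa⁻¹ = A at *
  generalize Wb⁻¹ = B at *
  -- `t1` says that w is orthogonal to the direction of the chord, `t2` that w is isotropic. The two
  -- vectors span the plane over the chord, so w is in the kernel of the restricted form and the
  -- Gram determinant vanishes.
  have t1 : B * (E * (p * A) + Db * (q * B)) = A * (Da * (p * A) + E * (q * B)) := by
    rw [hDa, hDb, hE]; linear_combination htan
  have t2 : p * A * (Da * (p * A) + E * (q * B)) + q * B * (E * (p * A) + Db * (q * B)) = 0 := by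
    rw [hDa, hDb, hE]; linear_combination hmem
  have hS : Da * (p * A) + E * (q * B) = 0 := by
    have : A * (Da * (p * A) + E * (q * B)) = 0 := by
      linear_combination t2 - q * t1 - (A * (Da * (p * A) + E * (q * B))) * hpq
    exact (mul_eq_zero.mp this).resolve_left hP.ne'
  have hT : E * (p * A) + Db * (q * B) = 0 := by
    rw [hS, mul_zero] at t1
    exact (mul_eq_zero.mp t1).resolve_left hQ.ne'
  have hG : Da * Db - E ^ 2 = 0 := by
    have g1 : (Da * Db - E ^ 2) * A * p = 0 := by linear_combination Db * hS - E * hT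
    have g2 : (Da * Db - E ^ 2) * B * q = 0 := by linear_combination Da * hT - E * hS
    have g3 : p = 0 ∨ (Da * Db - E ^ 2) = 0 := by
      rcases mul_eq_zero.mp g1 with g | g
      · exact Or.inr ((mul_eq_zero.mp g).resolve_right hP.ne')
      · exact Or.inl g
    rcases g3 with g3 | g3
    · have q1 : q = 1 := by linarith
      rw [q1, mul_one] at g2
      exact (mul_eq_zero.mp g2).resolve_right hQ.ne'
    · exact g3
  rw [hG] at hgram
  have hne : 4 * (a ^ 2 * b ^ 2 * Real.sin d ^ 2) ≠ 0 := by
    have := hab.pos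
    have := hab.pos'
    positivity
  have := (mul_eq_zero.mp hgram.symm).resolve_left hne
  linarith

lemma framePoint_step_unique (h : IsAdaptedFrame Co Ci M a b c) (hab : IsAxes a b) {t u : ℝ}
    (hs : IsPonceletStep Ci (framePoint M t) (framePoint M u)) :
    framePoint M u = framePoint M (chordMap a b t) := by
  obtain ⟨hne, htan, hleft⟩ := hs
  have hpi := Real.two_pi_pos
  -- Moving the end angle into [t, t + 2π) puts the half-angle of the chord in (0, π), where its
  -- sine is positive; the left-hand condition then brings it below π/2.
  set n : ℤ := ⌊(u - t) / (2 * Real.pi)⌋ with hn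
  set v := u + (-n : ℤ) * (2 * Real.pi) with hv
  have hv' : framePoint M u = framePoint M v := (framePoint_add M u _).symm
  rw [hv'] at hne htan hleft ⊢
  have h1 : t ≤ v := by
    have := (le_div_iff₀ hpi).mp (Int.floor_le ((u - t) / (2 * Real.pi)))
    rw [hv]; push_cast; linarith
  have h2 : v < t + 2 * Real.pi := by
    have := (div_lt_iff₀ hpi).mp (Int.lt_floor_add_one ((u - t) / (2 * Real.pi)))
    rw [hv]; push_cast; linarith
  have h3 : t < v := lt_of_le_of_ne h1 fun he => hne (by rw [he])
  have ht : t = (t + (v - t) / 2) - (v - t) / 2 := by ring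
  have hv2 : v = (t + (v - t) / 2) + (v - t) / 2 := by ring
  have hsin : 0 < Real.sin ((v - t) / 2) :=
    Real.sin_pos_of_pos_of_lt_pi (by linarith) (by linarith)
  have hT : framePoint M t = framePoint M ((t + (v - t) / 2) - (v - t) / 2) := by rw [← ht]
  have hV : framePoint M v = framePoint M ((t + (v - t) / 2) + (v - t) / 2) := by rw [← hv2]
  rw [hT, hV] at htan hleft
  have hcos := h.cos_pos_of_left hab hsin hleft
  have hrel := h.tangency_of_tangent hab hsin htan
  have hlt : (v - t) / 2 < Real.pi / 2 := by
    by_contra hge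
    have := Real.cos_nonpos_of_pi_div_two_le_of_le (not_lt.mp hge) (by linarith)
    linarith
  have := hab.eq_arctan_of_tangency (by linarith) hlt hrel
  rw [chordMap, ← this, mul_div_cancel₀ _ two_ne_zero, add_sub_cancel]

lemma isPonceletStep_chordMap (h : IsAdaptedFrame Co Ci M a b c) (hab : IsAxes a b) (t : ℝ) :
    IsPonceletStep Ci (framePoint M t) (framePoint M (chordMap a b t)) := by
  have hrel := hab.tangency t
  have h0 := Real.arctan_pos.mpr (hab.chordTan_pos t)
  have h1 := Real.arctan_lt_pi_div_two (chordTan a b t)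
  set d := Real.arctan (chordTan a b t) with hd
  set s := t + d with hs
  have ht : t = s - d := by rw [hs]; ring
  have hu : chordMap a b t = s + d := by rw [chordMap, ← hd, hs]; ring
  clear_value s
  have hsin : 0 < Real.sin d := Real.sin_pos_of_pos_of_lt_pi h0 (by linarith [Real.pi_pos])
  have hcos : 0 < Real.cos d := Real.cos_arctan_pos _
  have hin := abs_lt.mp (hab.tangent_point_inside hsin hcos hrel)
  have ha := hab.pos
  have hb := hab.pos'
  rw [hu, ht]
  refine ⟨fun he => ?_, ?_, fun w hw => ?_⟩
  · obtain ⟨n, hn⟩ := h.framePoint_injective he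
    have hpi := Real.pi_pos
    have n0 : (0 : ℝ) < n := by
      refine (mul_pos_iff_of_pos_right Real.two_pi_pos).mp ?_
      linarith
    have n1 : (1 : ℝ) ≤ n := by
      have : 0 < n := by exact_mod_cast n0
      exact_mod_cast this
    nlinarith
  -- P and Q are the weights of the tangent point in the homogeneous end points, positive by
  -- `tangent_point_inside`. Multiplied by the heights Wa and Wb, they become barycentric weights in
  -- the affine plane.
  · set P := Real.sin d * Real.cos d - (b ^ 2 - a ^ 2) * (Real.sin s * Real.cos s) with hP
    set Q := Real.sin d * Real.cos d + (b ^ 2 - a ^ 2) * (Real.sin s * Real.cos s) with hQ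
    have P0 : 0 < P := by linarith
    have Q0 : 0 < Q := by linarith
    have hwa := h.weight_pos (s - d)
    have hwb := h.weight_pos (s + d)
    have ea := hom_affinePoint hwa.ne'
    have eb := hom_affinePoint hwb.ne'
    change ![(framePoint M (s - d)).1, (framePoint M (s - d)).2, 1] = _ at ea
    change ![(framePoint M (s + d)).1, (framePoint M (s + d)).2, 1] = _ at eb
    set z₀ := framePoint M (s - d)
    set z₁ := framePoint M (s + d)
    set Wa := (M *ᵥ circlePoint (s - d)) 2
    set Wb := (M *ᵥ circlePoint (s + d)) 2
    have hS : 0 < P * Wa + Q * Wb := add_pos (mul_pos P0 hwa) (mul_pos Q0 hwb)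
    set S := P * Wa + Q * Wb with hSdef
    have hpq : P * Wa / S + Q * Wb / S = 1 := by rw [← add_div, ← hSdef, div_self hS.ne']
    set y : Fin 3 → ℝ := ![a ^ 2 * Real.cos s, b ^ 2 * Real.sin s, Real.cos d] with hy
    have hcomb : P • circlePoint (s - d) + Q • circlePoint (s + d) = (2 * Real.sin d) • y := by
      have hs2 := Real.sin_sq_add_cos_sq s
      ext i
      fin_cases i
      · change P * Real.cos (s - d) + Q * Real.cos (s + d) =
          2 * Real.sin d * (a ^ 2 * Real.cos s)
        rw [Real.cos_sub, Real.cos_add, hP, hQ]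
        linear_combination (-2 * Real.sin d * Real.cos s) * hrel +
          (2 * a ^ 2 * Real.sin d * Real.cos s) * hs2
      · change P * Real.sin (s - d) + Q * Real.sin (s + d) =
          2 * Real.sin d * (b ^ 2 * Real.sin s)
        rw [Real.sin_sub, Real.sin_add, hP, hQ]
        linear_combination (-2 * Real.sin d * Real.sin s) * hrel +
          (2 * b ^ 2 * Real.sin d * Real.sin s) * hs2
      · change P * 1 + Q * 1 = 2 * Real.sin d * Real.cos d
        rw [hP, hQ]; ring
    have ew : ![((P * Wa / S) • z₀ + (Q * Wb / S) • z₁).1,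
        ((P * Wa / S) • z₀ + (Q * Wb / S) • z₁).2, 1] = M *ᵥ ((S⁻¹ * (2 * Real.sin d)) • y) := by
      rw [mul_smul, ← hcomb, Matrix.mulVec_smul, Matrix.mulVec_add, Matrix.mulVec_smul,
        Matrix.mulVec_smul]
      have ea' : M *ᵥ circlePoint (s - d) = Wa • ![z₀.1, z₀.2, 1] := by
        rw [ea, smul_smul, mul_inv_cancel₀ hwa.ne', one_smul]
      have eb' : M *ᵥ circlePoint (s + d) = Wb • ![z₁.1, z₁.2, 1] := by
        rw [eb, smul_smul, mul_inv_cancel₀ hwb.ne', one_smul]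
      rw [ea', eb']
      ext i
      fin_cases i
      · simp; field_simp
      · simp; field_simp
      · simp; rw [← hSdef, inv_mul_cancel₀ hS.ne']
    have ev : ![(z₁ - z₀).1, (z₁ - z₀).2, 0] =
        M *ᵥ (Wb⁻¹ • circlePoint (s + d) - Wa⁻¹ • circlePoint (s - d)) := by
      rw [Matrix.mulVec_sub, Matrix.mulVec_smul, Matrix.mulVec_smul, ← ea, ← eb]
      ext i
      fin_cases i <;> simp
    have y0 : y 0 = a ^ 2 * Real.cos s := rfl
    have y1 : y 1 = b ^ 2 * Real.sin s := rfl
    have y2 : y 2 = Real.cos d := rfl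
    refine ⟨(P * Wa / S) • z₀ + (Q * Wb / S) • z₁,
      ⟨_, _, (div_pos (mul_pos P0 hwa) hS).le, (div_pos (mul_pos Q0 hwb) hS).le, hpq, rfl⟩, ?_, ?_⟩
    · change quadForm Ci _ = 0
      rw [ew, h.quadForm_inner]
      simp only [Pi.smul_apply, smul_eq_mul, y0, y1, y2]
      linear_combination (c * a ^ 2 * b ^ 2 * (S⁻¹ * (2 * Real.sin d)) ^ 2) * hrel
    · rw [ev, ew, h.inner]
      simp only [Pi.smul_apply, Pi.sub_apply, smul_eq_mul, y0, y1, y2, circlePoint_zero,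
        circlePoint_one, circlePoint_two, Real.cos_sub, Real.cos_add, Real.sin_sub, Real.sin_add]
      have hs2 := Real.sin_sq_add_cos_sq s
      linear_combination (c * a ^ 2 * b ^ 2 * (S⁻¹ * (2 * Real.sin d)) * (Wb⁻¹ - Wa⁻¹) *
        Real.cos d) * hs2
  · have hMy := h.mulVec_inv ![w.1, w.2, 1]
    have hw' : quadForm Ci ![w.1, w.2, 1] = 0 := hw
    set y := M⁻¹ *ᵥ ![w.1, w.2, 1]
    rw [← hMy, h.quadForm_inner] at hw'
    have hq := (mul_eq_zero.mp hw').resolve_left h.scale_pos.ne'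
    have hM2 : 0 < (M *ᵥ y) 2 := by rw [hMy]; exact one_pos
    have hcone : y 0 ^ 2 + y 1 ^ 2 ≤ y 2 ^ 2 := by
      have e1 : a ^ 2 * (y 0 ^ 2 + y 1 ^ 2) ≤ a ^ 2 * (b ^ 2 * y 2 ^ 2) := by
        have : a ^ 2 ≤ b ^ 2 := by nlinarith [hab.lt]
        nlinarith [mul_nonneg (sub_nonneg.mpr this) (sq_nonneg (y 0))]
      have e2 := le_of_mul_le_mul_left e1 (by positivity)
      nlinarith [mul_nonneg (sub_pos.mpr hab.sq_lt_one').le (sq_nonneg (y 2))]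
    have hy2 := h.third_pos hcone hM2
    have hw0 : affinePoint (M *ᵥ y) = w :=
      affinePoint_of_hom w one_ne_zero (by rw [hMy, one_smul])
    rw [← hw0, h.isOnLeft_framePoint_iff hsin hM2]
    -- Cauchy–Schwarz: (y₀ cos s + y₁ sin s)² ≤ (y₀²/a² + y₁²/b²)(a² cos² s + b² sin² s) = y₂² cos²
    -- d.
    refine (le_abs_self _).trans (abs_le_of_sq_le_sq ?_ (mul_pos hy2 hcos).le)
    have e3 : 0 < a ^ 2 * b ^ 2 := by positivity
    refine le_of_mul_le_mul_left ?_ e3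
    rw [mul_pow, ← hrel]
    nlinarith [sq_nonneg (b ^ 2 * y 0 * Real.sin s - a ^ 2 * y 1 * Real.cos s)]

end IsAdaptedFrame

/-! ### Centre and polar covering of an ellipse -/

namespace IsEllipseMatrix

variable {C : Matrix (Fin 3) (Fin 3) ℝ}

lemma quadForm_eq (h : IsEllipseMatrix C) (u : Fin 3 → ℝ) :
    quadForm C u = C 0 0 * u 0 ^ 2 + C 1 1 * u 1 ^ 2 + C 2 2 * u 2 ^ 2 +
      2 * (C 0 1 * (u 0 * u 1) + C 0 2 * (u 0 * u 2) + C 1 2 * (u 1 * u 2)) := by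
  simp only [quadForm, Matrix.mulVec, dotProduct, Fin.sum_univ_three, h.symm.apply 0 1,
    h.symm.apply 0 2, h.symm.apply 1 2]
  ring

lemma det_eq (h : IsEllipseMatrix C) :
    C.det = C 0 0 * C 1 1 * C 2 2 + 2 * (C 0 1 * C 0 2 * C 1 2) - C 0 0 * C 1 2 ^ 2 -
      C 1 1 * C 0 2 ^ 2 - C 2 2 * C 0 1 ^ 2 := by
  rw [Matrix.det_fin_three, h.symm.apply 0 1, h.symm.apply 0 2, h.symm.apply 1 2]
  ring

lemma minorDet_pos (h : IsEllipseMatrix C) : 0 < minorDet C := by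
  have h1 := h.pos 1 0 (by simp)
  rw [h.quadForm_eq] at h1
  simp only [Matrix.cons_val_zero, Matrix.cons_val_one, Matrix.cons_val] at h1
  have h0 : 0 < C 0 0 := by linarith
  have h2 := h.pos (-C 0 1) (C 0 0) (by simp [h0.ne'])
  rw [h.quadForm_eq] at h2
  simp only [Matrix.cons_val_zero, Matrix.cons_val_one, Matrix.cons_val] at h2
  have h3 : 0 < C 0 0 * (C 0 0 * C 1 1 - C 0 1 ^ 2) := by linarith
  exact (mul_pos_iff_of_pos_left h0).mp h3

/-- The centre is the critical point of the form on the affine plane, so the linear terms cancel,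
and the critical value is the quotient of determinants. -/
lemma quadForm_center_add (h : IsEllipseMatrix C) (x y : ℝ) :
    quadForm C ![(center C).1 + x, (center C).2 + y, 1] =
      quadForm C ![x, y, 0] + C.det / minorDet C := by
  have hm := h.minorDet_pos.ne'
  rw [h.quadForm_eq, h.quadForm_eq, h.det_eq, center]
  simp only [Matrix.cons_val_zero, Matrix.cons_val_one, Matrix.cons_val]
  rw [minorDet] at *
  field_simp
  ring

lemma quadForm_dir_pos (h : IsEllipseMatrix C) (θ : ℝ) :
    0 < quadForm C ![Real.cos θ, Real.sin θ, 0] :=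
  h.pos _ _ fun h0 => by
    rw [Prod.mk.injEq] at h0
    have := Real.sin_sq_add_cos_sq θ
    rw [h0.1, h0.2] at this
    norm_num at this

lemma _root_.quadForm_ray (C : Matrix (Fin 3) (Fin 3) ℝ) (k x y : ℝ) :
    quadForm C ![k * x, k * y, 0] = k ^ 2 * quadForm C ![x, y, 0] := by
  rw [← quadForm_smul]
  congr 1
  ext i; fin_cases i <;> simp

lemma radius_arg_pos (h : IsEllipseMatrix C) (θ : ℝ) :
    0 < -C.det / (minorDet C * quadForm C ![Real.cos θ, Real.sin θ, 0]) :=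
  div_pos (neg_pos.mpr h.det_neg) (mul_pos h.minorDet_pos (h.quadForm_dir_pos θ))

lemma radius_pos (h : IsEllipseMatrix C) (θ : ℝ) : 0 < radius C θ :=
  Real.sqrt_pos.mpr (h.radius_arg_pos θ)

lemma mem_conic_iff_eq_radius (h : IsEllipseMatrix C) (θ : ℝ) {k : ℝ} (hk : 0 < k) :
    ((center C).1 + k * Real.cos θ, (center C).2 + k * Real.sin θ) ∈ conic C ↔
      k = radius C θ := by
  change quadForm C ![(center C).1 + k * Real.cos θ, (center C).2 + k * Real.sin θ, 1] = 0 ↔ _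
  rw [h.quadForm_center_add, quadForm_ray, radius, eq_comm (a := k),
    Real.sqrt_eq_iff_mul_self_eq (h.radius_arg_pos θ).le hk.le]
  have h1 := (h.quadForm_dir_pos θ).ne'
  have h2 := h.minorDet_pos.ne'
  rw [div_eq_iff (mul_ne_zero h2 h1)]
  field_simp
  constructor <;> intro h' <;> linear_combination -h'

lemma ellipseCover_mem (h : IsEllipseMatrix C) (t : ℝ) : ellipseCover C t ∈ conic C :=
  (h.mem_conic_iff_eq_radius _ (h.radius_pos _)).mpr rfl

lemma ellipseCover_injective (h : IsEllipseMatrix C) {s t : ℝ}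
    (hst : ellipseCover C s = ellipseCover C t) : ∃ n : ℤ, s = t + n := by
  rw [ellipseCover, ellipseCover, Prod.mk.injEq] at hst
  have e1 := add_left_cancel hst.1
  have e2 := add_left_cancel hst.2
  have r1 := h.radius_pos (2 * Real.pi * s)
  have r2 := h.radius_pos (2 * Real.pi * t)
  have c1 := Real.sin_sq_add_cos_sq (2 * Real.pi * s)
  have c2 := Real.sin_sq_add_cos_sq (2 * Real.pi * t)
  have hr : radius C (2 * Real.pi * s) = radius C (2 * Real.pi * t) := by
    refine (pow_left_inj₀ r1.le r2.le two_ne_zero).mp ?_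
    calc radius C (2 * Real.pi * s) ^ 2 = (radius C (2 * Real.pi * s) * Real.cos (2 * Real.pi * s)) ^ 2
          + (radius C (2 * Real.pi * s) * Real.sin (2 * Real.pi * s)) ^ 2 := by
            linear_combination (-radius C (2 * Real.pi * s) ^ 2) * c1
      _ = _ := by rw [e1, e2]; linear_combination (radius C (2 * Real.pi * t) ^ 2) * c2
  rw [hr] at e1 e2
  obtain ⟨n, hn⟩ := Real.exists_int_of_cos_eq_of_sin_eq (mul_left_cancel₀ r2.ne' e1)
    (mul_left_cancel₀ r2.ne' e2)
  refine ⟨n, mul_left_cancel₀ Real.two_pi_pos.ne' ?_⟩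
  rw [hn]; ring

end IsEllipseMatrix

/-! ### Lifts and the rotation number -/

lemma continuous_int_valued_const {f : ℝ → ℝ} (hf : Continuous f) (hint : ∀ x, ∃ n : ℤ, f x = n) :
    ∃ n : ℤ, ∀ x, f x = n := by
  choose g hg using hint
  have hgc : Continuous g := by
    rw [Int.isClosedEmbedding_coe_real.isInducing.continuous_iff]
    exact hf.congr hg
  exact ⟨g 0, fun x => by rw [hg x, PreconnectedSpace.constant inferInstance hgc (x := x) (y := 0)]⟩

/-- The rotation number can be computed from any lift. -/
lemma IsEllipseMatrix.rotationNumber_eq {C : Matrix (Fin 3) (Fin 3) ℝ} (h : IsEllipseMatrix C)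
    {P : conic C → conic C} {F : CircleDeg1Lift} (hF : IsLift C P F) :
    rotationNumber C P = Int.fract (CircleDeg1Lift.translationNumber F) := by
  have hex : ∃ F : CircleDeg1Lift, IsLift C P F := ⟨F, hF⟩
  rw [rotationNumber, dif_pos hex]
  have hG := hex.choose_spec
  set G := hex.choose
  -- Two lifts cover the same point, so they differ by an integer depending continuously on t, hence
  -- by a constant.
  obtain ⟨n, hn⟩ := continuous_int_valued_const (f := fun t => G t - F t) (hG.1.sub hF.1)
    fun t => by
      have e1 := hG.2 t ⟨_, h.ellipseCover_mem t⟩ rfl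
      have e2 := hF.2 t ⟨_, h.ellipseCover_mem t⟩ rfl
      obtain ⟨n, hn⟩ := h.ellipseCover_injective (e1.symm.trans e2)
      exact ⟨n, by rw [hn]; ring⟩
  have hGF : G = (CircleDeg1Lift.translate (Multiplicative.ofAdd (n : ℝ)) : CircleDeg1Lift) * F := by
    ext t
    rw [CircleDeg1Lift.mul_apply, CircleDeg1Lift.translate_apply]
    linarith [hn t]
  have hcomm : Commute (CircleDeg1Lift.translate (Multiplicative.ofAdd (n : ℝ)) : CircleDeg1Lift)
      F := by
    rw [CircleDeg1Lift.commute_iff_commute]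
    intro t
    rw [CircleDeg1Lift.translate_apply, CircleDeg1Lift.translate_apply, F.map_int_add]
  rw [hGF, CircleDeg1Lift.translationNumber_mul_of_commute hcomm,
    CircleDeg1Lift.translationNumber_translate, Int.fract_intCast_add]

namespace IsAdaptedFrame

variable {Co Ci M : Matrix (Fin 3) (Fin 3) ℝ} {a b c : ℝ}

/-- The parametrization by the unit circle, read off by the polar angle at the centre. -/
lemma exists_angle (h : IsAdaptedFrame Co Ci M a b c) (hC : IsEllipseMatrix Co) :
    ∃ θ : ℝ → ℝ, Continuous θ ∧ StrictMono θ ∧ (∀ t, θ (t + 2 * Real.pi) = θ t + 2 * Real.pi) ∧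
      ∀ t, ellipseCover Co (θ t / (2 * Real.pi)) = framePoint M t := by
  set e := center Co with he
  set dir : ℝ → Fin 3 → ℝ := fun t => ![-Real.sin t, Real.cos t, 0] with hdir
  have hexp : ∀ (u : Fin 3 → ℝ) (i : Fin 3), (M *ᵥ u) i = M i 0 * u 0 + M i 1 * u 1 + M i 2 * u 2 :=
    fun u i => by simp [Matrix.mulVec, dotProduct, Fin.sum_univ_three]
  have hder : ∀ (i : Fin 3) (t : ℝ),
      HasDerivAt (fun t => (M *ᵥ circlePoint t) i) ((M *ᵥ dir t) i) t := fun i t => by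
    simp only [hexp, circlePoint_zero, circlePoint_one, circlePoint_two]
    refine ((((Real.hasDerivAt_cos t).const_mul _).add
      ((Real.hasDerivAt_sin t).const_mul _)).add (hasDerivAt_const t _)).congr_deriv ?_
    simp [hdir]
  have hcont : ∀ i : Fin 3, Continuous fun t => (M *ᵥ dir t) i := fun i => by
    simp only [hexp, hdir, Matrix.cons_val_zero, Matrix.cons_val_one, Matrix.cons_val]
    fun_prop
  have hper : ∀ t, circlePoint (t + 2 * Real.pi) = circlePoint t := fun t => by
    simp [circlePoint]
  have hper' : ∀ t, dir (t + 2 * Real.pi) = dir t := fun t => by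
    simp [hdir]
  have hcoord : ∀ t, (M *ᵥ circlePoint t) 0 - e.1 * (M *ᵥ circlePoint t) 2 =
        (M *ᵥ circlePoint t) 2 * ((framePoint M t).1 - e.1) ∧
      (M *ᵥ circlePoint t) 1 - e.2 * (M *ᵥ circlePoint t) 2 =
        (M *ᵥ circlePoint t) 2 * ((framePoint M t).2 - e.2) := fun t => by
    have := (h.weight_pos t).ne'
    simp only [framePoint, affinePoint]
    constructor <;> field_simp
  have hQ : ∀ t, quadForm Co ![(framePoint M t).1 - e.1, (framePoint M t).2 - e.2, 0] =
      -(Co.det / minorDet Co) := fun t => by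
    have h1 := hC.quadForm_center_add ((framePoint M t).1 - e.1) ((framePoint M t).2 - e.2)
    rw [← he, add_sub_cancel, add_sub_cancel] at h1
    have h2 : quadForm Co ![(framePoint M t).1, (framePoint M t).2, 1] = 0 := h.framePoint_mem t
    linarith
  have hneg : Co.det / minorDet Co < 0 := div_neg_of_neg_of_pos hC.det_neg hC.minorDet_pos
  -- The curve is the vector from the centre to the frame point, multiplied by the positive height.
  -- Its direction is unchanged and its coordinates are trigonometric polynomials.
  obtain ⟨θ, hc, hm, hp, hθ⟩ := exists_polar_angle_of_periodic
    (X := fun t => (M *ᵥ circlePoint t) 0 - e.1 * (M *ᵥ circlePoint t) 2)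
    (Y := fun t => (M *ᵥ circlePoint t) 1 - e.2 * (M *ᵥ circlePoint t) 2)
    (X' := fun t => (M *ᵥ dir t) 0 - e.1 * (M *ᵥ dir t) 2)
    (Y' := fun t => (M *ᵥ dir t) 1 - e.2 * (M *ᵥ dir t) 2)
    (fun t => (hder 0 t).sub ((hder 2 t).const_mul _))
    (fun t => (hder 1 t).sub ((hder 2 t).const_mul _))
    ((hcont 0).sub ((hcont 2).const_mul _)) ((hcont 1).sub ((hcont 2).const_mul _))
    (fun t => by
      have hMg := h.mulVec_inv ![e.1, e.2, 1]
      set g := M⁻¹ *ᵥ ![e.1, e.2, 1]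
      -- The areal velocity is a determinant with the centre as third vector. Pulled back by the
      -- frame, it is positive because the preimage g of the centre is inside the unit disc.
      have h1 : tripleProduct (M *ᵥ circlePoint t) (M *ᵥ dir t) (M *ᵥ g) =
          ((M *ᵥ circlePoint t) 0 - e.1 * (M *ᵥ circlePoint t) 2) *
            ((M *ᵥ dir t) 1 - e.2 * (M *ᵥ dir t) 2) -
          ((M *ᵥ circlePoint t) 1 - e.2 * (M *ᵥ circlePoint t) 2) *
            ((M *ᵥ dir t) 0 - e.1 * (M *ᵥ dir t) 2) := by
        rw [hMg]
        simp only [tripleProduct, Matrix.cons_val_zero, Matrix.cons_val_one, Matrix.cons_val]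
        ring
      rw [← h1, tripleProduct_mulVec]
      refine mul_pos h.det_pos ?_
      have h2 : tripleProduct (circlePoint t) (dir t) g =
          g 2 - g 0 * Real.cos t - g 1 * Real.sin t := by
        simp only [tripleProduct, hdir, circlePoint_zero, circlePoint_one, circlePoint_two,
          Matrix.cons_val_zero, Matrix.cons_val_one, Matrix.cons_val]
        linear_combination g 2 * Real.sin_sq_add_cos_sq t
      rw [h2]
      have h3 : quadForm Co (M *ᵥ g) < 0 := by
        have := hC.quadForm_center_add 0 0
        rw [add_zero, add_zero, ← he] at this
        have h0 : quadForm Co ![0, 0, 0] = 0 := by simp [quadForm, dotProduct, Fin.sum_univ_three]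
        rw [hMg, this, h0, zero_add]
        exact hneg
      rw [h.quadForm_outer] at h3
      have hg2 : 0 < g 2 := h.third_pos (by linarith) (by rw [hMg]; exact one_pos)
      have h4 : (g 0 * Real.cos t + g 1 * Real.sin t) ^ 2 < g 2 ^ 2 := by
        have hs : Real.sin t ^ 2 = 1 - Real.cos t ^ 2 := by linarith [Real.sin_sq_add_cos_sq t]
        have : (g 0 * Real.cos t + g 1 * Real.sin t) ^ 2 =
            g 0 ^ 2 + g 1 ^ 2 - (g 0 * Real.sin t - g 1 * Real.cos t) ^ 2 := by
          linear_combination (g 0 ^ 2 + g 1 ^ 2) * hs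
        nlinarith [sq_nonneg (g 0 * Real.sin t - g 1 * Real.cos t)]
      have := abs_lt_of_sq_lt_sq h4 hg2.le
      linarith [(abs_lt.mp this).2])
    (fun t => by simp only [hper]) (fun t => by simp only [hper])
    (fun t => by simp only [hper']) (fun t => by simp only [hper'])
    (fun s t k hk hX hY => by
      have hs := h.weight_pos s
      have ht := h.weight_pos t
      rw [(hcoord s).1, (hcoord t).1] at hX
      rw [(hcoord s).2, (hcoord t).2] at hY
      set Ws := (M *ᵥ circlePoint s) 2
      set Wt := (M *ᵥ circlePoint t) 2
      have hκ : 0 < k * Wt / Ws := div_pos (mul_pos hk ht) hs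
      have e1 : (framePoint M s).1 - e.1 = k * Wt / Ws * ((framePoint M t).1 - e.1) := by
        field_simp; linarith
      have e2 : (framePoint M s).2 - e.2 = k * Wt / Ws * ((framePoint M t).2 - e.2) := by
        field_simp; linarith
      have h1 := hQ s
      rw [e1, e2, quadForm_ray, hQ t] at h1
      -- Two points of the ellipse on the same ray from the centre have equal value of the form, so
      -- they coincide.
      have h2 : (k * Wt / Ws) ^ 2 = 1 := by
        have : -(Co.det / minorDet Co) ≠ 0 := by linarith
        exact mul_right_cancel₀ this (by linarith)
      have h3 : k * Wt / Ws = 1 := (pow_eq_one_iff_of_nonneg hκ.le two_ne_zero).mp h2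
      rw [h3, one_mul] at e1 e2
      exact h.framePoint_injective (Prod.ext (by linarith) (by linarith)))
  refine ⟨θ, hc, hm, hp, fun t => ?_⟩
  obtain ⟨k, hk, hX, hY⟩ := hθ t
  rw [(hcoord t).1] at hX
  rw [(hcoord t).2] at hY
  have ht := h.weight_pos t
  set Wt := (M *ᵥ circlePoint t) 2
  have hkW : 0 < k / Wt := div_pos hk ht
  have e1 : (framePoint M t).1 = e.1 + k / Wt * Real.cos (θ t) := by
    field_simp; linarith
  have e2 : (framePoint M t).2 = e.2 + k / Wt * Real.sin (θ t) := by
    field_simp; linarith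
  have hpt : framePoint M t = (e.1 + k / Wt * Real.cos (θ t), e.2 + k / Wt * Real.sin (θ t)) :=
    Prod.ext e1 e2
  have hmem := h.framePoint_mem t
  rw [hpt, hC.mem_conic_iff_eq_radius _ hkW] at hmem
  rw [ellipseCover, mul_div_cancel₀ _ Real.two_pi_pos.ne', hpt, hmem]

/-- A Poncelet map has a lift which is semiconjugate to the one of the normal form. -/
lemma exists_lift (h : IsAdaptedFrame Co Ci M a b c) (hab : IsAxes a b) (hC : IsEllipseMatrix Co)
    {P : conic Co → conic Co} (hP : IsPonceletMap Co Ci P) :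
    ∃ F : CircleDeg1Lift, IsLift Co P F ∧
      CircleDeg1Lift.translationNumber F = CircleDeg1Lift.translationNumber hab.turnMap := by
  obtain ⟨θ, hc, hm, hp, hθ⟩ := h.exists_angle hC
  have hpi := Real.two_pi_pos
  have hsm : StrictMono fun t => θ (2 * Real.pi * t) / (2 * Real.pi) := fun x y hxy =>
    div_lt_div_of_pos_right (hm (mul_lt_mul_of_pos_left hxy hpi)) hpi
  let H : CircleDeg1Lift :=
    { toFun := fun t => θ (2 * Real.pi * t) / (2 * Real.pi)
      monotone' := hsm.monotone
      map_add_one' := fun t => by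
        rw [mul_add, mul_one, hp, add_div, div_self hpi.ne'] }
  have hHc : Continuous H := (hc.comp (continuous_const.mul continuous_id)).div_const _
  have hHs : Function.Surjective H := hHc.surjective H.tendsto_atTop H.tendsto_atBot
  have hHm : StrictMono H := hsm
  have hcov : ∀ t, ellipseCover Co (H t) = framePoint M (2 * Real.pi * t) := fun t => hθ _
  let e : ℝ ≃o ℝ := hHm.orderIsoOfSurjective H hHs
  have he : ∀ t, H (e.symm t) = t := fun t => e.apply_symm_apply t
  have he' : ∀ t, e.symm (H t) = t := fun t => e.symm_apply_apply t
  -- The normal form conjugated by the reparametrization H of degree one; such a conjugation keeps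
  -- the translation number.
  let F : CircleDeg1Lift :=
    { toFun := fun t => H (hab.turnMap (e.symm t))
      monotone' := fun x y hxy => hHm.monotone (hab.turnMap.monotone (e.symm.monotone hxy))
      map_add_one' := fun t => by
        have : e.symm (t + 1) = e.symm t + 1 := hHm.injective (by rw [he, H.map_add_one, he])
        rw [this, hab.turnMap.map_add_one, H.map_add_one] }
  have hF : ∀ t, F t = H (hab.turnMap (e.symm t)) := fun t => rfl
  refine ⟨F, ⟨hHc.comp (hab.continuous_turnMap.comp e.symm.continuous), fun t z hz => ?_⟩, ?_⟩
  · have h1 := hP z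
    have h2 : (z : ℝ × ℝ) = framePoint M (2 * Real.pi * e.symm t) := by rw [← hcov, he, hz]
    obtain ⟨u, hu⟩ := h.exists_framePoint (P z).2
    rw [← hu, h2] at h1
    rw [← hu, hF, hcov, hab.two_pi_mul_turnMap]
    exact h.framePoint_step_unique hab h1
  · refine (CircleDeg1Lift.translationNumber_eq_of_semiconj (f := H) fun t => ?_).symm
    rw [hF, he']

lemma existsUnique_ponceletMap (h : IsAdaptedFrame Co Ci M a b c) (hab : IsAxes a b) :
    ∃! P : conic Co → conic Co, IsPonceletMap Co Ci P := by
  choose τ hτ using fun z : conic Co => h.exists_framePoint z.2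
  refine ⟨fun z => ⟨framePoint M (chordMap a b (τ z)), h.framePoint_mem _⟩, fun z => ?_,
    fun P hP => funext fun z => Subtype.ext ?_⟩
  · have := h.isPonceletStep_chordMap hab (τ z)
    rwa [hτ] at this
  · have h1 := hP z
    obtain ⟨u, hu⟩ := h.exists_framePoint (P z).2
    rw [← hu, ← hτ z] at h1
    rw [← hu]
    exact h.framePoint_step_unique hab h1

end IsAdaptedFrame

/-! ### Conclusion -/

lemma IsEllipsePair.isAxes {Co Ci : Matrix (Fin 3) (Fin 3) ℝ} {l₁ l₂ l₃ : ℝ}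
    (h : IsEllipsePair Co Ci l₁ l₂ l₃) : IsAxes √(l₃ / l₁) √(l₃ / l₂) := by
  have p3 := h.pos₃
  have p2 : 0 < l₂ := p3.trans h.lt₂₃
  have p1 : 0 < l₁ := p2.trans h.lt₁₂
  refine ⟨Real.sqrt_pos.mpr (div_pos p3 p1), ?_, ?_⟩
  · exact Real.sqrt_lt_sqrt (div_pos p3 p1).le (div_lt_div_of_pos_left p3 p2 h.lt₁₂)
  · rw [Real.sqrt_lt' one_pos, one_pow, div_lt_one p2]
    exact h.lt₂₃

theorem mainTheorem8 :
    (∀ (Co Ci : Matrix (Fin 3) (Fin 3) ℝ) (lam₁ lam₂ lam₃ : ℝ),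
      IsEllipsePair Co Ci lam₁ lam₂ lam₃ →
      (∃! P : conic Co → conic Co, IsPonceletMap Co Ci P) ∧
      ∀ P : conic Co → conic Co, IsPonceletMap Co Ci P →
        (∃ F : CircleDeg1Lift, IsLift Co P F) ∧
        (rotationNumber Co P = 1 / 4 ↔ lam₁ * lam₂ - lam₁ * lam₃ - lam₂ * lam₃ = 0) ∧
        (rotationNumber Co P = 1 / 3 ↔ 1 / √lam₃ = 1 / √lam₁ + 1 / √lam₂) ∧
        (rotationNumber Co P = 1 / 6 ↔ √(1 - lam₃ / lam₁) + √(1 - lam₃ / lam₂) = 1)) ∧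
    (∀ a r R : ℝ, 0 < a → 0 < r → r + a < R →
      ∃ lam₁ lam₂ lam₃ : ℝ,
        IsEllipsePair (circleMatrix 0 R) (circleMatrix a r) lam₁ lam₂ lam₃ ∧
        (lam₁ * lam₂ - lam₁ * lam₃ - lam₂ * lam₃ = 0 ↔
          1 / (R - a) ^ 2 + 1 / (R + a) ^ 2 = 1 / r ^ 2) ∧
        (1 / √lam₃ = 1 / √lam₁ + 1 / √lam₂ ↔ 1 / (R - a) + 1 / (R + a) = 1 / r)) := by
  refine ⟨fun Co Ci l₁ l₂ l₃ h => ?_, fun a r R ha hr hR => circle_pair ha hr hR⟩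
  obtain ⟨M, hM⟩ := h.exists_frame
  have hab := h.isAxes
  have p3 := h.pos₃
  have p2 : 0 < l₂ := p3.trans h.lt₂₃
  have p1 : 0 < l₁ := p2.trans h.lt₁₂
  refine ⟨hM.existsUnique_ponceletMap hab, fun P hP => ?_⟩
  obtain ⟨F, hF, hFτ⟩ := hM.exists_lift hab h.outer hP
  have hrot : ∀ {n : ℕ}, 0 < n → (rotationNumber Co P = 1 / n ↔
      (chordMap √(l₃ / l₁) √(l₃ / l₂))^[n] 0 = 2 * Real.pi) := fun hn => by
    rw [h.outer.rotationNumber_eq hF, hFτ, hab.fract_translationNumber_turnMap,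
      hab.translationNumber_turnMap_eq_iff hn]
  have sq1 : √(l₃ / l₁) ^ 2 = l₃ / l₁ := Real.sq_sqrt (div_pos p3 p1).le
  have sq2 : √(l₃ / l₂) ^ 2 = l₃ / l₂ := Real.sq_sqrt (div_pos p3 p2).le
  refine ⟨⟨F, hF⟩, ?_, ?_, ?_⟩
  · have := hrot (n := 4) (by norm_num)
    rw [hab.iterate_four_iff, sq1, sq2] at this
    rw [← Nat.cast_ofNat (R := ℝ) (n := 4), this]
    field_simp
    constructor <;> intro h' <;> linarith
  · have := hrot (n := 3) (by norm_num)
    rw [hab.iterate_three_iff, Real.sqrt_div' _ p1.le, Real.sqrt_div' _ p2.le] at this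
    rw [← Nat.cast_ofNat (R := ℝ) (n := 3), this]
    have := Real.sqrt_pos.mpr p1
    have := Real.sqrt_pos.mpr p2
    have := Real.sqrt_pos.mpr p3
    field_simp
    constructor <;> intro h' <;> linarith
  · have := hrot (n := 6) (by norm_num)
    rw [hab.iterate_six_iff, sq1, sq2] at this
    rw [← Nat.cast_ofNat (R := ℝ) (n := 6), this]
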